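/- All graphs are finite and simple. A Roman dominating function on a graph $G$ is a function $f:V(G)\to\{0,1,2\}$ such that every vertex $v$ with $f(v)=0$ has a neighbor $u$ with $f(u)=2$; its weight is $\sum_{v} f(v)$, and $\gamma_R(G)$ is the minimum weight of a Roman dominating function on $G$. Let $\mathcal R_{UVR}$ be the class of graphs $G$ with $\gamma_R(G-v)=\gamma_R(G)$ for all $v\in V(G)$. Let $\mathscr T$ be the family of trees $T$ that have a labeling $S:V(T)\to\{A,B,C\}$ such that $(T,S)$ can be obtained from the labeled star $K_{1,2}$ (leaves labeled $A$, center labeled $B$) by a finite (possibly empty) sequence of the following operations on labeled trees, in which old vertices keep their labels: * O1: add a new path $x,y,z$ and an edge $ux$, where $u$ is an old vertex labeled $A$ or $C$; label $x,z$ with $A$ and $y$ with $B$. * O2: add a new star with center $y$ and leaves $x,z,t$ and an edge $ux$, where $u$ is an old vertex labeled $B$; label $x$ with $C$, $z,t$ with $A$ and $y$ with $B$. * O3: add a new path $x,y,z$ and an edge $uy$, where $u$ is an old vertex labeled $C$; label $x,z$ with $A$ and $y$ with $B$. * O4: add a new copy of the labeled tree $R$ (obtained from the labeled $K_{1,2}$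 by one operation O2) and an edge $ux$, where $u$ is an old vertex labeled $A$ or $C$ and $x$ is the vertex of $R$ labeled $C$. **Theorem.** For a nonnegative integer $n$, call a graph $G$ *minimum* (of order $n$) if $G$ is a connected graph of order $n$ in $\mathcal R_{UVR}$ and $|E(G)|\le |E(H)|$ for every connected graph $H$ of order $n$ in $\mathcal R_{UVR}$. (i) Connected graphs of order $n$ in $\mathcal R_{UVR}$ exist and have minimum size $n-1$ if and only if $n\in\{3,6,7\}\cup\{9,10,\dots\}$. Moreover, for every minimum graph $G$ of order $n$, $|E(G)|=n-1$ if and only if $n\in\{3,6,7\}\cup\{9,10,\dots\}$ and $G\in\mathscr T$. (ii) If $n\in\{4,5\}$, then the minimum size of a connected graph of order $n$ in $\mathcal R_{UVR}$ is $2n-3$, and, up to isomorphism, $K_2\vee\overline{K_{n-2}}$ is the only minimum graph of order $n$. Here $\vee$ denotes the join (the disjoint union together with all edges between the two parts). (iii) If $n=8$, then the minimum size of a connected graph of order $n$ in $\mathcal R_{UVR}$ is $8$, and, up to isomorphism, the only minimum graph of order $8$ is the graph consisting of a cycle $x_1x_2x_3x_4$ together with two leaves attached to $x_1$ and two leaves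 attached to $x_3$. -/

import Mathlib

namespace RomanUVR

/-- A Roman dominating function: a labeling of the vertices by `0, 1, 2` such that every vertex
with label `0` has a neighbor with label `2`. -/
def IsRDF {V : Type*} (G : SimpleGraph V) (f : V → Fin 3) : Prop :=
  ∀ v, f v = 0 → ∃ u, G.Adj v u ∧ f u = 2

/-- The weight of a labeling: the sum of all its labels. -/
def weight {V : Type*} [Fintype V] (f : V → Fin 3) : ℕ :=
  ∑ v, (f v : ℕ)

/-- The Roman domination number: the minimum weight of a Roman dominating function
(the constant function `2` is one, so the set is never empty). -/
noncomputable def romanNumber {V : Type*} [Fintype V] (G : SimpleGraph V) : ℕ :=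
  sInf {w : ℕ | ∃ f : V → Fin 3, IsRDF G f ∧ weight f = w}

/-- The class of graphs whose Roman domination number is unchanged by deleting any one vertex. -/
def InRUVR {V : Type*} [Fintype V] [DecidableEq V] (G : SimpleGraph V) : Prop :=
  ∀ v : V, romanNumber (G.induce {w | w ≠ v}) = romanNumber G

/-- The sizes (numbers of edges) of the connected graphs with vertex set `V` in the class. -/
def connectedSizes (V : Type*) [Fintype V] [DecidableEq V] : Set ℕ :=
  {m | ∃ G : SimpleGraph V, G.Connected ∧ InRUVR G ∧ G.edgeSet.ncard = m}

/-- `G` is connected, in the class, and has the minimum number of edges among all such graphs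
of the same order. As the class is closed under isomorphism, it is enough to compare `G` with the
graphs on the same vertex set. -/
def IsMinimumSize {V : Type*} [Fintype V] [DecidableEq V] (G : SimpleGraph V) : Prop :=
  G.Connected ∧ InRUVR G ∧
    ∀ H : SimpleGraph V, H.Connected → InRUVR H → G.edgeSet.ncard ≤ H.edgeSet.ncard

/-- The three statuses of a vertex of a labeled tree. -/
inductive Status : Type
  | A
  | B
  | C

open Status

/-- The disjoint union of `G` and `H` together with the edge joining `u` in `G` to `x` in `H`. -/
def attach {V W : Type*} (G : SimpleGraph V) (u : V) (H : SimpleGraph W) (x : W) :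
    SimpleGraph (V ⊕ W) :=
  (G ⊕g H) ⊔ SimpleGraph.edge (Sum.inl u) (Sum.inr x)

/-- The labels `A, B, A` along the path on three vertices; with them the path is the labeled
star with two leaves, and also the path `x, y, z` that is added by two of the operations. -/
def pathLabel : Fin 3 → Status := ![A, B, A]

/-- The star with center `y = 1` and leaves `x = 0`, `z = 2`, `t = 3`. -/
def star3 : SimpleGraph (Fin 4) := SimpleGraph.starGraph 1

/-- The labels of the added star: `x` has status `C`, `y` status `B`, `z` and `t` status `A`. -/
def star3Label : Fin 4 → Status := ![C, B, A, A]

/-- The labeled tree `R`: the star is added to the labeled path on three vertices by the edge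
that joins the center (status `B`) of the path to the leaf `x = 0` (status `C`) of the star. -/
def treeR : SimpleGraph (Fin 3 ⊕ Fin 4) :=
  attach (SimpleGraph.pathGraph 3) 1 star3 0

/-- The labels of `R`. Its only vertex of status `C` is `Sum.inr 0`. -/
def treeRLabel : Fin 3 ⊕ Fin 4 → Status := Sum.elim pathLabel star3Label

/-- The labeled trees (up to isomorphism) that are built from the labeled path on three vertices
by the four operations. -/
inductive LabeledFamily : (V : Type) → SimpleGraph V → (V → Status) → Prop
  | base : LabeledFamily (Fin 3) (SimpleGraph.pathGraph 3) pathLabel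
  /-- Add a path `x, y, z` and the edge `ux`, where `u` has status `A` or `C`. -/
  | op1 {V : Type} {T : SimpleGraph V} {S : V → Status} (h : LabeledFamily V T S)
      (u : V) (hu : S u = A ∨ S u = C) :
      LabeledFamily (V ⊕ Fin 3) (attach T u (SimpleGraph.pathGraph 3) 0) (Sum.elim S pathLabel)
  /-- Add a star with leaves `x, z, t` and the edge `ux`, where `u` has status `B`. -/
  | op2 {V : Type} {T : SimpleGraph V} {S : V → Status} (h : LabeledFamily V T S)
      (u : V) (hu : S u = B) :
      LabeledFamily (V ⊕ Fin 4) (attach T u star3 0) (Sum.elim S star3Label)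
  /-- Add a path `x, y, z` and the edge `uy`, where `u` has status `C`. -/
  | op3 {V : Type} {T : SimpleGraph V} {S : V → Status} (h : LabeledFamily V T S)
      (u : V) (hu : S u = C) :
      LabeledFamily (V ⊕ Fin 3) (attach T u (SimpleGraph.pathGraph 3) 1) (Sum.elim S pathLabel)
  /-- Add a labeled `R` and the edge from its vertex of status `C` to `u`, where `u` has status
  `A` or `C`. -/
  | op4 {V : Type} {T : SimpleGraph V} {S : V → Status} (h : LabeledFamily V T S)
      (u : V) (hu : S u = A ∨ S u = C) :
      LabeledFamily (V ⊕ (Fin 3 ⊕ Fin 4)) (attach T u treeR (Sum.inr 0))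
        (Sum.elim S treeRLabel)

/-- The graph `G` is, for some labeling, isomorphic to a tree of the family. -/
def InFamilyT {V : Type*} (G : SimpleGraph V) : Prop :=
  ∃ (W : Type) (T : SimpleGraph W) (S : W → Status),
    LabeledFamily W T S ∧ Nonempty (G ≃g T)

/-- The join of two graphs: the disjoint union together with all edges between the two parts. -/
def join {V W : Type*} (G : SimpleGraph V) (H : SimpleGraph W) : SimpleGraph (V ⊕ W) :=
  (G ⊕g H) ⊔ completeBipartiteGraph V W

/-- The unicyclic graph on eight vertices that consists of the cycle `0, 1, 2, 3` and two leaves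
at each of the opposite vertices `0` and `2` of the cycle. -/
def unicyclic8 : SimpleGraph (Fin 8) :=
  SimpleGraph.fromEdgeSet
    {s(0, 1), s(1, 2), s(2, 3), s(3, 0), s(0, 4), s(0, 5), s(2, 6), s(2, 7)}

end RomanUVR

/-!
# Minimum connected graphs whose Roman domination number survives the deletion of any vertex

Let `G` be in the class. A Roman dominating function of minimum weight never takes the value `1`
(deleting a vertex of value `1` would lower the Roman domination number), so it is `twice B`, with
value `2` on a set `B` and `0` elsewhere. Every `b ∈ B` has at least three closed private
neighbours, as otherwise the value `2` at `b` could be replaced by values `1` on these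
(`InRUVR.exists_twice`). In particular `3 * #B` is at most the order.

*Trees.* The heart of the matter is the counting lemma `eq_twice_or_lt_weight`: in a forest, a
function that dominates three chosen closed private neighbours of each `b ∈ B` is equal to
`twice B` or heavier. Applied to a Roman dominating function of `G - b` it shows that `b` has exactly
two private neighbours and no neighbour in `B`; hence the vertices carry statuses with the local
properties collected in `IsStatusLabeling`. Conversely, by the same lemma, `twice B` is the only
minimum function of a forest with such a labeling, and this puts the forest into the class
(`IsStatusLabeling.inRUVR_of_isAcyclic`). Finally, the trees with a status labeling are exactly the
trees of the family: the operations preserve these local properties, and a copy of a labeled tree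
of the family inside a larger labeled tree can be enlarged by an operation at any edge that leaves
it; which operation applies depends only on the statuses at the two ends
(`IsStatusLabeling.exists_larger`). So `inFamilyT_iff` holds, and the orders of these trees are the
numbers `3 + 3 * a + 4 * b`.

*Orders four and five.* Here `#B = 1`, so there is a universal vertex `v`, and `G - v` needs a
universal vertex too. Thus `G` contains the join of `K₂` with an empty graph.

*Order eight.* There is no tree of this order in the class, so there are at least eight edges. If
there are exactly eight, then `#B = 2`, since two universal vertices give thirteen edges. A count of
the edges (`card_private_lt_three`) shows that each vertex of `B` has only two private neighbours,
so that there are two common neighbours, and the eight edges found are those of `unicyclic8`.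
-/

namespace RomanUVR

open Finset Status

/-! ### Roman domination and vertex deletion -/

section Basic

variable {V W : Type*} [Fintype V] [Fintype W]

theorem romanNumber_le {G : SimpleGraph V} {f : V → Fin 3} (hf : IsRDF G f) :
    romanNumber G ≤ weight f :=
  Nat.sInf_le ⟨f, hf, rfl⟩

theorem exists_isRDF_weight_eq (G : SimpleGraph V) :
    ∃ f, IsRDF G f ∧ weight f = romanNumber G :=
  Nat.sInf_mem (s := {w : ℕ | ∃ f : V → Fin 3, IsRDF G f ∧ weight f = w})
    ⟨_, fun _ => 2, fun v h => by simp at h, rfl⟩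

theorem romanNumber_le_of_iso {G : SimpleGraph V} {H : SimpleGraph W} (e : G ≃g H) :
    romanNumber G ≤ romanNumber H := by
  obtain ⟨f, hf, hw⟩ := exists_isRDF_weight_eq H
  rw [← hw]
  have h : weight (f ∘ e) = weight f := Equiv.sum_comp e.toEquiv (fun v => (f v : ℕ))
  rw [← h]
  refine romanNumber_le fun v hv => ?_
  obtain ⟨u, hu, hu2⟩ := hf (e v) hv
  exact ⟨e.symm u, by rw [← e.map_adj_iff]; simpa using hu, by simpa using hu2⟩

theorem romanNumber_congr {G : SimpleGraph V} {H : SimpleGraph W} (e : G ≃g H) :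
    romanNumber G = romanNumber H :=
  (romanNumber_le_of_iso e).antisymm (romanNumber_le_of_iso e.symm)

theorem InRUVR.of_iso [DecidableEq V] [DecidableEq W] {G : SimpleGraph V} {H : SimpleGraph W}
    (e : G ≃g H) (h : InRUVR H) : InRUVR G := by
  intro v
  rw [romanNumber_congr e, ← h (e v)]
  refine romanNumber_congr ⟨e.toEquiv.subtypeEquiv fun w => ?_, ?_⟩
  · simp
  · intro a b
    exact e.map_adj_iff

/-- Restricting a function to the complement of `v` removes exactly its value at `v`. -/
theorem weight_restrict [DecidableEq V] (f : V → Fin 3) (v : V) :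
    weight (fun w : {w | w ≠ v} => f w) + (f v : ℕ) = weight f := by
  unfold weight
  rw [← Finset.sum_erase_add _ _ (Finset.mem_univ v)]
  congr 1
  exact (Finset.sum_subtype (univ.erase v) (p := fun w => w ∈ {w | w ≠ v}) (by simp)
    (fun w => (f w : ℕ))).symm

/-- `g` vanishes at `b` and dominates every other vertex: such functions are the extensions
by `0` of the Roman dominating functions of `G - b`. -/
def IsRDFOff (G : SimpleGraph V) (b : V) (g : V → Fin 3) : Prop :=
  g b = 0 ∧ ∀ v, v ≠ b → g v = 0 → ∃ u, G.Adj v u ∧ g u = 2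

theorem IsRDFOff.romanNumber_le [DecidableEq V] {G : SimpleGraph V} {b : V} {g : V → Fin 3}
    (hg : IsRDFOff G b g) : romanNumber (G.induce {w | w ≠ b}) ≤ weight g := by
  have h := weight_restrict g b
  rw [hg.1] at h
  rw [← h]
  refine RomanUVR.romanNumber_le fun v hv => ?_
  obtain ⟨u, hu, hu2⟩ := hg.2 v v.2 hv
  refine ⟨⟨u, ?_⟩, hu, hu2⟩
  rintro rfl
  rw [hg.1] at hu2
  simp at hu2

theorem exists_isRDFOff [DecidableEq V] (G : SimpleGraph V) (b : V) :
    ∃ g, IsRDFOff G b g ∧ weight g = romanNumber (G.induce {w | w ≠ b}) := by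
  obtain ⟨f, hf, hw⟩ := exists_isRDF_weight_eq (G.induce {w | w ≠ b})
  refine ⟨fun v => if h : v ≠ b then f ⟨v, h⟩ else 0, ⟨by simp, ?_⟩, ?_⟩
  · intro v hv h0
    simp only [ne_eq, hv, not_false_eq_true, dite_true] at h0
    obtain ⟨u, hu, hu2⟩ := hf _ h0
    have := u.2
    simp only [Set.mem_ofPred_eq] at this
    exact ⟨u, hu, by simpa [this] using hu2⟩
  · rw [← hw, ← weight_restrict _ b]
    simp only [ne_eq, not_true_eq_false, dite_false, Fin.val_zero, add_zero]
    unfold weight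
    refine Finset.sum_congr rfl fun x _ => ?_
    have := x.2
    simp only [Set.mem_ofPred_eq] at this
    simp [this]

theorem InRUVR.exists_isRDFOff [DecidableEq V] {G : SimpleGraph V} (hG : InRUVR G) (b : V) :
    ∃ g, IsRDFOff G b g ∧ weight g = romanNumber G := by
  rw [← hG b]
  exact RomanUVR.exists_isRDFOff G b

/-- In a graph of the class a Roman dominating function of minimum weight never takes the
value `1`, as deleting a vertex with this value would lower the Roman domination number. -/
theorem InRUVR.ne_one [DecidableEq V] {G : SimpleGraph V} (hG : InRUVR G) {f : V → Fin 3}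
    (hf : IsRDF G f) (hw : weight f ≤ romanNumber G) (v : V) : f v ≠ 1 := by
  intro h1
  have h := weight_restrict f v
  have h2 : romanNumber (G.induce {w | w ≠ v}) + (f v : ℕ) ≤ weight f := by
    refine (Nat.add_le_add_right (romanNumber_le fun w hw0 => ?_) _).trans h.le
    obtain ⟨u, hu, hu2⟩ := hf w hw0
    refine ⟨⟨u, ?_⟩, hu, hu2⟩
    rintro rfl
    rw [h1] at hu2
    simp at hu2
  rw [hG v, h1] at h2
  simp only [Fin.val_one] at h2
  omega

theorem inRUVR_of_forall [DecidableEq V] {G : SimpleGraph V}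
    (h1 : ∀ f, IsRDF G f → weight f = romanNumber G → ∀ v, f v ≠ 1)
    (h2 : ∀ v, ∃ g, IsRDFOff G v g ∧ weight g ≤ romanNumber G) : InRUVR G := by
  intro v
  obtain ⟨g, hg, hw⟩ := h2 v
  refine le_antisymm (hg.romanNumber_le.trans hw) ?_
  by_contra! hlt
  obtain ⟨g, hg, hw⟩ := exists_isRDFOff G v
  have hwt : weight (Function.update g v 1) = weight g + 1 := by
    unfold weight
    rw [← Finset.sum_erase_add _ _ (Finset.mem_univ v),
      ← Finset.sum_erase_add (a := v) _ (fun w => (g w : ℕ)) (Finset.mem_univ v)]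
    rw [hg.1]
    simp only [Function.update_self, Fin.val_one, Fin.val_zero, add_zero]
    congr 1
    refine Finset.sum_congr rfl fun x hx => ?_
    rw [Function.update_of_ne (Finset.ne_of_mem_erase hx)]
  have hrdf : IsRDF G (Function.update g v 1) := by
    intro w hw0
    have hwv : w ≠ v := by
      rintro rfl
      simp at hw0
    rw [Function.update_of_ne hwv] at hw0
    obtain ⟨u, hu, hu2⟩ := hg.2 w hwv hw0
    refine ⟨u, hu, ?_⟩
    rw [Function.update_of_ne]
    · exact hu2
    · rintro rfl
      rw [hg.1] at hu2
      simp at hu2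
  have := romanNumber_le hrdf
  exact h1 _ hrdf (by omega) v (by simp)

end Basic

/-! ### Private neighbourhoods -/

section Private

variable {V : Type*} [DecidableEq V]

/-- The function with value `2` on `B` and `0` elsewhere. -/
def twice (B : Finset V) (v : V) : Fin 3 := if v ∈ B then 2 else 0

theorem twice_eq_two {B : Finset V} {v : V} : twice B v = 2 ↔ v ∈ B := by
  unfold twice; split <;> simp_all

theorem twice_eq_zero {B : Finset V} {v : V} : twice B v = 0 ↔ v ∉ B := by
  unfold twice; split <;> simp_all

variable [Fintype V]

theorem weight_twice (B : Finset V) : weight (twice B) = 2 * #B := by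
  have (v : V) : ((twice B v : Fin 3) : ℕ) = if v ∈ B then 2 else 0 := by
    unfold twice; split <;> rfl
  simp [weight, this, mul_comm]

open Classical in
/-- The closed private neighbourhood of `b` with respect to `B`: the vertices of the closed
neighbourhood of `b` that lie in the closed neighbourhood of no other vertex of `B`. -/
noncomputable def privateNbrs (G : SimpleGraph V) (B : Finset V) (b : V) : Finset V :=
  {v | (v = b ∨ G.Adj v b) ∧ ∀ x ∈ B, x ≠ b → v ≠ x ∧ ¬ G.Adj v x}

theorem mem_privateNbrs {G : SimpleGraph V} {B : Finset V} {b v : V} :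
    v ∈ privateNbrs G B b ↔
      (v = b ∨ G.Adj v b) ∧ ∀ x ∈ B, x ≠ b → v ≠ x ∧ ¬ G.Adj v x := by
  simp [privateNbrs]

/-- A Roman dominating function of minimum weight in a graph of the class has the form
`twice B`, and each `b ∈ B` has at least three closed private neighbours: otherwise replacing
the value at `b` by the value `1` on these would give a function that is not heavier. -/
theorem InRUVR.exists_twice {G : SimpleGraph V} (hG : InRUVR G) :
    ∃ B : Finset V, IsRDF G (twice B) ∧ romanNumber G = 2 * #B ∧
      ∀ b ∈ B, 3 ≤ #(privateNbrs G B b) := by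
  obtain ⟨f, hf, hw⟩ := exists_isRDF_weight_eq G
  have hne := hG.ne_one hf hw.le
  set B : Finset V := {v | f v = 2} with hB
  have hfB : f = twice B := by
    funext v
    have := hne v
    simp only [twice, hB, mem_filter, mem_univ, true_and]
    split
    · assumption
    · have h3 : ∀ x : Fin 3, x ≠ 1 → x ≠ 2 → x = 0 := by decide
      exact h3 _ (hne v) ‹_›
  rw [hfB] at hf hw
  refine ⟨B, hf, by rw [← hw, weight_twice], fun b hb => ?_⟩
  by_contra! hlt
  set P := privateNbrs G B b with hP
  have hPB : ∀ v ∈ P, v ∉ B.erase b := by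
    intro v hv hvB
    rw [mem_erase] at hvB
    exact ((mem_privateNbrs.1 hv).2 v hvB.2 hvB.1).1 rfl
  let f' : V → Fin 3 := fun v => if v ∈ B.erase b then 2 else if v ∈ P then 1 else 0
  have hrdf : IsRDF G f' := by
    intro v hv
    have hvB : v ∉ B.erase b := fun h => by
      simp only [f', h, if_true] at hv
      exact absurd hv (by decide)
    have hvP : v ∉ P := fun h => by
      simp only [f', h, hvB, if_true, if_false] at hv
      exact absurd hv (by decide)
    rw [hP, mem_privateNbrs] at hvP
    push Not at hvP
    have key : v = b ∨ G.Adj v b → ∃ u, G.Adj v u ∧ f' u = 2 := by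
      intro h
      obtain ⟨x, hx, hxb, hadj⟩ := hvP h
      have hxB : x ∈ B.erase b := mem_erase.2 ⟨hxb, hx⟩
      refine ⟨x, hadj ?_, by simp [f', hx, hxb]⟩
      rintro rfl
      exact hvB hxB
    by_cases hvb : v = b
    · exact key (.inl hvb)
    · have hvB' : v ∉ B := fun h => hvB (mem_erase.2 ⟨hvb, h⟩)
      obtain ⟨u, hu, hu2⟩ := hf v (twice_eq_zero.2 hvB')
      rw [twice_eq_two] at hu2
      by_cases hub : u = b
      · exact key (.inr (hub ▸ hu))
      · exact ⟨u, hu, by simp [f', hu2, hub]⟩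
  have hwt : weight f' = 2 * #(B.erase b) + #P := by
    have hv (v : V) : ((f' v : Fin 3) : ℕ) =
        (if v ∈ B.erase b then 2 else 0) + (if v ∈ P then 1 else 0) := by
      have := hPB v
      by_cases h1 : v ∈ P
      · simp only [f', h1, this h1] ; rfl
      · by_cases h2 : v ∈ B.erase b <;> simp only [f', h1, h2] <;> rfl
    simp only [weight, hv, sum_add_distrib]
    rw [← sum_filter, ← sum_filter, filter_univ_mem, filter_univ_mem]
    simp [mul_comm]
  rw [weight_twice] at hw
  have hcard := card_erase_add_one hb
  have hle := romanNumber_le hrdf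
  have hPpos : 0 < #P := by omega
  obtain ⟨v, hv⟩ := card_pos.1 hPpos
  refine hG.ne_one hrdf (by omega) v ?_
  simp only [f', hPB v hv, hv, if_true, if_false]

/-- The closed private neighbourhoods are disjoint, so `B` is at most a third of the vertices. -/
theorem three_mul_card_le {G : SimpleGraph V} {B : Finset V}
    (h3 : ∀ b ∈ B, 3 ≤ #(privateNbrs G B b)) : 3 * #B ≤ Fintype.card V := by
  have hdisj : (B : Set V).PairwiseDisjoint (privateNbrs G B) := by
    intro b hb b' hb' hne
    refine disjoint_left.2 fun v hv hv' => ?_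
    rw [mem_privateNbrs] at hv hv'
    have := hv.2 b' hb' hne.symm
    tauto
  have := card_biUnion hdisj
  have h2 := card_nsmul_le_sum B (fun b => #(privateNbrs G B b)) 3 h3
  have h4 := card_le_univ (B.biUnion (privateNbrs G B))
  simp only [smul_eq_mul] at h2
  omega

end Private

/-! ### The counting lemma for forests -/

section Forest

variable {V : Type*} {G : SimpleGraph V}

theorem not_adj_of_isAcyclic (hG : G.IsAcyclic) {a b c : V} (hab : G.Adj a b)
    (hac : G.Adj a c) : ¬ G.Adj b c := by
  classical
  intro hbc
  exact hG.cliqueFree le_rfl {a, b, c} (SimpleGraph.is3Clique_triple_iff.2 ⟨hab, hac, hbc⟩)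

theorem card_edges_add_one_le (hG : G.IsAcyclic) (S : Finset V) (hS : S.Nonempty)
    (E : Finset (Sym2 V)) (hE : ∀ e ∈ E, e ∈ G.edgeSet ∧ ∀ v ∈ e, v ∈ S) : #E + 1 ≤ #S := by
  classical
  have : Nonempty S := hS.to_subtype
  obtain ⟨T, hT, -, hTree⟩ :=
    (SimpleGraph.connected_top (V := S)).exists_isTree_le_of_le_of_isAcyclic le_top (hG.induce (S : Set V))
  have hcard := hTree.card_edgeFinset
  have hsub : E ⊆ T.edgeFinset.image (Sym2.map Subtype.val) := by
    intro e he
    obtain ⟨h1, h2⟩ := hE e he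
    induction e with
    | _ x y =>
      rw [SimpleGraph.mem_edgeSet] at h1
      refine mem_image.2 ⟨s(⟨x, h2 x (by simp)⟩, ⟨y, h2 y (by simp)⟩), ?_, by simp⟩
      rw [SimpleGraph.mem_edgeFinset, SimpleGraph.mem_edgeSet]
      exact hT h1
  have := (card_le_card hsub).trans card_image_le
  have h3 : Fintype.card S = #S := Fintype.card_coe S
  omega

variable [Fintype V] [DecidableEq V]

/-- The counting lemma. Let `G` be a forest, and let each `b ∈ B` have a set `Q b` of at least
three closed private neighbours. If `g` dominates, in the sense of Roman domination, all vertices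
of the sets `Q b`, then `g` is heavier than `twice B` or equal to it.

Call the star `insert b (Q b)` active if `g` differs from `twice B` on it. A vertex `v` of an
active star with `g v = 0` needs a neighbour of value `2`, and if `g b ≠ 2` this neighbour is
outside the star, with a single possible exception. So an active star of total value `t` has at
least `3 - t` such edges. In the forest that results from contracting the active stars there are
fewer edges than vertices, hence `∑ (3 - t) < #(active stars) + #(other vertices of positive
value)`, which says that `g` is heavier than `twice B`. -/
theorem eq_twice_or_lt_weight (hG : G.IsAcyclic) (B : Finset V) (Q : V → Finset V)
    (hQ : ∀ b ∈ B, Q b ⊆ privateNbrs G B b) (h3 : ∀ b ∈ B, 3 ≤ #(Q b)) (g : V → Fin 3)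
    (hg : ∀ b ∈ B, ∀ v ∈ Q b, g v = 0 → ∃ u, G.Adj v u ∧ g u = 2) :
    g = twice B ∨ 2 * #B < weight g := by
  classical
  have hfin : ∀ x : Fin 3, x ≠ 0 → 1 ≤ (x : ℕ) := by decide
  have hQ1 {b v : V} (hb : b ∈ B) (hv : v ∈ Q b) : v = b ∨ G.Adj v b :=
    (mem_privateNbrs.1 (hQ b hb hv)).1
  have hQ2 {b v x : V} (hb : b ∈ B) (hv : v ∈ Q b) (hx : x ∈ B) (hxb : x ≠ b) :
      v ≠ x ∧ ¬ G.Adj v x := (mem_privateNbrs.1 (hQ b hb hv)).2 x hx hxb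
  set P : V → Finset V := fun b => insert b (Q b) with hP
  have hPdisj : (B : Set V).PairwiseDisjoint P := by
    intro b hb b' hb' hne
    refine disjoint_left.2 fun v hv hv' => ?_
    rw [hP, mem_insert] at hv hv'
    rcases hv with rfl | hv
    · rcases hv' with rfl | hv'
      · exact hne rfl
      · exact (hQ2 hb' hv' hb hne).1 rfl
    · rcases hv' with rfl | hv'
      · exact (hQ2 hb hv hb' hne.symm).1 rfl
      · have := hQ2 hb hv hb' hne.symm
        have := hQ1 hb' hv'
        tauto
  choose! u hu hu2 using hg
  -- the active stars
  set B1 : Finset V := {b ∈ B | ¬ (g b = 2 ∧ ∀ v ∈ Q b, v ≠ b → g v = 0)} with hB1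
  set C1 : Finset V := {c | c ∉ B.biUnion P ∧ g c ≠ 0} with hC1
  have hB1B : B1 ⊆ B := filter_subset _ _
  have hdisj1 : (B1 : Set V).PairwiseDisjoint P := hPdisj.subset (by exact_mod_cast hB1B)
  set S : Finset V := B1.biUnion P ∪ C1 with hS
  -- the vertices of the star at `b` that need an edge leaving the star
  set N : V → Finset V := fun b =>
    if g b = 2 then ∅ else {v ∈ Q b | g v = 0 ∧ u b v ∉ P b} with hN
  have hNQ (b : V) : N b ⊆ Q b := by
    simp only [hN]; split
    · exact empty_subset _
    · exact filter_subset _ _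
  have huB {b v : V} (hb : b ∈ B) (hv : v ∈ Q b) (h0 : g v = 0) (hgb : g b ≠ 2) :
      u b v ∉ B := by
    intro h
    by_cases hub : u b v = b
    · exact hgb (hub ▸ hu2 b hb v hv h0)
    · exact (hQ2 hb hv h hub).2 (hu b hb v hv h0)
  have hNcard : ∀ b ∈ B1, 3 ≤ #(N b) + ∑ v ∈ P b, (g v : ℕ) := by
    intro b hb1
    have hb : b ∈ B := hB1B hb1
    have hbact := (mem_filter.1 hb1).2
    by_cases hgb : g b = 2
    · push Not at hbact
      obtain ⟨v, hv, hvb, hv0⟩ := hbact hgb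
      have hsub : ({b, v} : Finset V) ⊆ P b := by
        intro x hx
        simp only [mem_insert, mem_singleton] at hx
        rcases hx with rfl | rfl
        · exact mem_insert_self _ _
        · exact mem_insert_of_mem hv
      have h1 := sum_le_sum_of_subset (f := fun v => (g v : ℕ)) hsub
      rw [sum_pair hvb.symm, hgb] at h1
      have h2 := hfin _ hv0
      simp only [Fin.val_two] at h1
      omega
    · have hQP : ∑ v ∈ Q b, (g v : ℕ) ≤ ∑ v ∈ P b, (g v : ℕ) :=
        sum_le_sum_of_subset (subset_insert _ _)
      have hNb : N b = {v ∈ Q b | g v = 0 ∧ u b v ∉ P b} := by simp [hN, hgb]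
      have hsplit := card_filter_add_card_filter_not (s := Q b) (fun v => g v = 0)
      have h3b := h3 b hb
      have hpos : #{v ∈ Q b | ¬ g v = 0} ≤ ∑ v ∈ Q b, (g v : ℕ) := by
        rw [card_filter]
        refine sum_le_sum fun v _ => ?_
        split
        · exact hfin _ ‹_›
        · exact Nat.zero_le _
      -- a neighbour of value `2` inside the star is possible for `b` only
      have hin : ∀ v ∈ Q b, g v = 0 → u b v ∈ P b → v = b := by
        intro v hv h0 hmem
        by_contra hvb
        have hadj := (hQ1 hb hv).resolve_left hvb
        have hne : u b v ≠ b := fun h => huB hb hv h0 hgb (by rw [h]; exact hb)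
        have hadj2 := (hQ1 hb ((mem_insert.1 hmem).resolve_left hne)).resolve_left hne
        exact not_adj_of_isAcyclic hG hadj (hu b hb v hv h0) hadj2.symm
      by_cases hex : b ∈ Q b ∧ g b = 0 ∧ u b b ∈ P b
      · obtain ⟨hbQ, hb0, hbP⟩ := hex
        have hne : u b b ≠ b := (hu b hb b hbQ hb0).ne'
        have huQ : u b b ∈ Q b := (mem_insert.1 hbP).resolve_left hne
        have hu2' := hu2 b hb b hbQ hb0
        have hpos' : #{v ∈ Q b | ¬ g v = 0} + 1 ≤ ∑ v ∈ Q b, (g v : ℕ) := by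
          rw [card_filter]
          refine Nat.succ_le_of_lt (sum_lt_sum (fun v _ => ?_) ⟨u b b, huQ, ?_⟩)
          · split
            · exact hfin _ ‹_›
            · exact Nat.zero_le _
          · rw [hu2']; decide
        have hsub : ({v ∈ Q b | g v = 0} : Finset V) ⊆ insert b (N b) := by
          intro v hv
          rw [mem_filter] at hv
          by_cases hmem : u b v ∈ P b
          · rw [hin v hv.1 hv.2 hmem]; exact mem_insert_self _ _
          · refine mem_insert_of_mem ?_
            rw [hNb, mem_filter]
            exact ⟨hv.1, hv.2, hmem⟩
        have := (card_le_card hsub).trans (card_insert_le _ _)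
        omega
      · have hsub : ({v ∈ Q b | g v = 0} : Finset V) ⊆ N b := by
          intro v hv
          rw [mem_filter] at hv
          rw [hNb, mem_filter]
          refine ⟨hv.1, hv.2, fun hmem => ?_⟩
          have := hin v hv.1 hv.2 hmem
          subst this
          exact hex ⟨hv.1, hv.2, hmem⟩
        have := card_le_card hsub
        omega
  -- the total value
  have hsum : weight g = ∑ b ∈ B, ∑ v ∈ P b, (g v : ℕ) + ∑ v ∈ univ \ B.biUnion P, (g v : ℕ) := by
    rw [← sum_biUnion hPdisj, add_comm, sum_sdiff (subset_univ _)]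
    rfl
  have hsumC : #C1 ≤ ∑ v ∈ univ \ B.biUnion P, (g v : ℕ) := by
    rw [card_eq_sum_ones]
    refine (sum_le_sum (f := fun _ => 1) (g := fun v => (g v : ℕ)) fun v hv => ?_).trans
      (sum_le_sum_of_subset (s := C1) fun v hv => ?_)
    · exact hfin _ (mem_filter.1 hv).2.2
    · simp only [hC1, mem_filter, mem_univ, true_and] at hv
      simpa using hv.1
  have hsumB : ∑ b ∈ B, ∑ v ∈ P b, (g v : ℕ) =
      ∑ b ∈ B1, ∑ v ∈ P b, (g v : ℕ) + 2 * #(B \ B1) := by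
    rw [← sum_sdiff hB1B, add_comm]
    congr 1
    rw [sum_congr rfl (g := fun _ => 2), sum_const, smul_eq_mul, mul_comm]
    intro b hb
    rw [mem_sdiff] at hb
    have h := hb.2
    simp only [hB1, mem_filter, hb.1, true_and, not_not] at h
    rw [← add_sum_erase _ _ (mem_insert_self b (Q b)), h.1, sum_eq_zero]
    · rfl
    · intro v hv
      rw [mem_erase, mem_insert] at hv
      rw [h.2 v (hv.2.resolve_left hv.1) hv.1]
      rfl
  have hBcard : #(B \ B1) + #B1 = #B := card_sdiff_add_card_eq_card hB1B
  by_cases hSne : S.Nonempty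
  · right
    -- the edges of the active stars, and those that are needed outside
    let E1 : V → Finset (Sym2 V) := fun b => ((P b).erase b).image fun v => s(v, b)
    let E2 : V → Finset (Sym2 V) := fun b => (N b).image fun v => s(v, u b v)
    have hNspec {b v : V} (hb : b ∈ B) (hv : v ∈ N b) :
        v ∈ Q b ∧ g v = 0 ∧ u b v ∉ P b ∧ u b v ∉ B := by
      have hgb : g b ≠ 2 := by
        intro h
        simp [hN, h] at hv
      simp only [hN, hgb, if_false, mem_filter] at hv
      exact ⟨hv.1, hv.2.1, hv.2.2, huB hb hv.1 hv.2.1 hgb⟩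
    have hE1 : ∀ b, #(E1 b) + 1 = #(P b) := by
      intro b
      rw [card_image_of_injOn, card_erase_add_one (mem_insert_self _ _)]
      intro v _ w _ hvw
      exact Sym2.congr_left.1 hvw
    have hE2 : ∀ b ∈ B1, #(E2 b) = #(N b) := by
      intro b hb
      refine card_image_of_injOn fun v hv w hw hvw => ?_
      have hv' := hNspec (hB1B hb) hv
      have hw' := hNspec (hB1B hb) hw
      rcases Sym2.eq_iff.1 hvw with h | h
      · exact h.1
      · exact absurd (mem_insert_of_mem hv'.1) (h.1 ▸ hw'.2.2.1)
    have hdE : ∀ b ∈ B1, Disjoint (E1 b) (E2 b) := by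
      intro b hb
      refine disjoint_left.2 fun e he he' => ?_
      obtain ⟨v, hv, rfl⟩ := mem_image.1 he
      obtain ⟨w, hw, hwe⟩ := mem_image.1 he'
      have hw' := hNspec (hB1B hb) hw
      have : u b w ∈ s(v, b) := hwe ▸ Sym2.mem_mk_right _ _
      rcases Sym2.mem_iff.1 this with h | h
      · exact hw'.2.2.1 (h ▸ mem_of_mem_erase hv)
      · exact hw'.2.2.1 (by rw [h]; exact mem_insert_self _ _)
    have hE1P {b : V} {e : Sym2 V} (he : e ∈ E1 b) : ∀ v ∈ e, v ∈ P b := by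
      obtain ⟨v, hv, rfl⟩ := mem_image.1 he
      intro w hw
      rcases Sym2.mem_iff.1 hw with rfl | rfl
      · exact mem_of_mem_erase hv
      · exact mem_insert_self _ _
    have hPeq {b b' v : V} (hb : b ∈ B1) (hb' : b' ∈ B1) (hv : v ∈ P b) (hv' : v ∈ P b') :
        b = b' := by
      by_contra hne
      exact disjoint_left.1 (hdisj1 hb hb' hne) hv hv'
    have hPN {b v : V} (hv : v ∈ N b) : v ∈ P b := mem_insert_of_mem (hNQ b hv)
    have hcross {b b' : V} (hb : b ∈ B1) (hb' : b' ∈ B1) {e : Sym2 V} (he : e ∈ E1 b)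
        (he' : e ∈ E2 b') : b = b' := by
      obtain ⟨w, hw, rfl⟩ := mem_image.1 he'
      exact hPeq hb hb' (hE1P he w (Sym2.mem_mk_left _ _)) (hPN hw)
    have hEdisj : (B1 : Set V).PairwiseDisjoint fun b => E1 b ∪ E2 b := by
      intro b hb b' hb' hne
      refine disjoint_left.2 fun e he he' => hne ?_
      rw [mem_union] at he he'
      rcases he with he | he <;> rcases he' with he' | he'
      · obtain ⟨v, hv, rfl⟩ := mem_image.1 he
        exact hPeq hb hb' (hE1P he v (Sym2.mem_mk_left _ _)) (hE1P he' v (Sym2.mem_mk_left _ _))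
      · exact hcross hb hb' he he'
      · exact (hcross hb' hb he' he).symm
      · obtain ⟨v, hv, rfl⟩ := mem_image.1 he
        obtain ⟨w, hw, hwe⟩ := mem_image.1 he'
        rcases Sym2.eq_iff.1 hwe with h | h
        · exact hPeq hb hb' (hPN hv) (h.1 ▸ hPN hw)
        · have h2 := hu2 b (hB1B hb) v (hNQ b hv) (hNspec (hB1B hb) hv).2.1
          rw [← h.1, (hNspec (hB1B hb') hw).2.1] at h2
          simp at h2
    have hmain := card_edges_add_one_le hG S hSne (B1.biUnion fun b => E1 b ∪ E2 b) ?_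
    · rw [card_biUnion hEdisj, sum_congr rfl fun b hb => card_union_of_disjoint (hdE b hb)] at hmain
      have hScard : #S ≤ ∑ b ∈ B1, #(P b) + #C1 := by
        refine (card_union_le _ _).trans ?_
        rw [card_biUnion hdisj1]
      have hsumE : ∑ b ∈ B1, #(P b) = ∑ b ∈ B1, #(E1 b) + #B1 := by
        rw [card_eq_sum_ones, ← sum_add_distrib]
        exact sum_congr rfl fun b _ => (hE1 b).symm
      rw [sum_add_distrib, sum_congr rfl hE2] at hmain
      have h3sum : 3 * #B1 ≤ ∑ b ∈ B1, #(N b) + ∑ b ∈ B1, ∑ v ∈ P b, (g v : ℕ) := by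
        rw [← sum_add_distrib, mul_comm, ← smul_eq_mul]
        exact card_nsmul_le_sum _ _ _ hNcard
      omega
    · intro e he
      rw [mem_biUnion] at he
      obtain ⟨b, hb, he⟩ := he
      rw [mem_union] at he
      have hPS : P b ⊆ S := fun v hv => mem_union_left _ (mem_biUnion.2 ⟨b, hb, hv⟩)
      rcases he with he | he
      · refine ⟨?_, fun v hv => hPS (hE1P he v hv)⟩
        obtain ⟨v, hv, rfl⟩ := mem_image.1 he
        rw [mem_erase, mem_insert] at hv
        exact (hQ1 (hB1B hb) (hv.2.resolve_left hv.1)).resolve_left hv.1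
      · obtain ⟨v, hv, rfl⟩ := mem_image.1 he
        obtain ⟨hvQ, h0, huP, huB'⟩ := hNspec (hB1B hb) hv
        refine ⟨hu b (hB1B hb) v hvQ h0, fun w hw => ?_⟩
        have hg2 := hu2 b (hB1B hb) v hvQ h0
        rcases Sym2.mem_iff.1 hw with rfl | rfl
        · exact hPS (hPN hv)
        · by_cases hmem : u b v ∈ B.biUnion P
          · obtain ⟨b', hb', hub'⟩ := mem_biUnion.1 hmem
            have hne : u b v ≠ b' := fun h => huB' (h ▸ hb')
            refine mem_union_left _ (mem_biUnion.2 ⟨b', ?_, hub'⟩)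
            rw [hB1, mem_filter]
            refine ⟨hb', fun h => ?_⟩
            have := h.2 _ ((mem_insert.1 hub').resolve_left hne) hne
            rw [hg2] at this
            simp at this
          · refine mem_union_right _ ?_
            rw [hC1, mem_filter]
            exact ⟨mem_univ _, hmem, by rw [hg2]; decide⟩
  · left
    rw [not_nonempty_iff_eq_empty, hS, union_eq_empty] at hSne
    have hB1e : B1 = ∅ := by
      by_contra h
      obtain ⟨b, hb⟩ := nonempty_iff_ne_empty.2 h
      have : b ∈ B1.biUnion P := mem_biUnion.2 ⟨b, hb, mem_insert_self _ _⟩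
      simp [hSne.1] at this
    have hall : ∀ b ∈ B, g b = 2 ∧ ∀ v ∈ Q b, v ≠ b → g v = 0 := by
      intro b hb
      by_contra h
      have : b ∈ B1 := mem_filter.2 ⟨hb, h⟩
      simp [hB1e] at this
    funext v
    unfold twice
    split_ifs with hv
    · exact (hall v hv).1
    · by_contra h0
      by_cases hmem : v ∈ B.biUnion P
      · obtain ⟨b, hb, hvb⟩ := mem_biUnion.1 hmem
        have hne : v ≠ b := fun h => hv (h ▸ hb)
        exact h0 ((hall b hb).2 v ((mem_insert.1 hvb).resolve_left hne) hne)
      · have : v ∈ C1 := mem_filter.2 ⟨mem_univ _, hmem, h0⟩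
        simp [hSne.2] at this

end Forest

/-! ### Status labelings -/

/-- The local conditions that the statuses satisfy in the labeled trees of the family: a vertex
of status `A` has exactly one neighbour of status `B`, a vertex of status `B` has no neighbour of
status `B` and exactly two neighbours of status `A`, and a vertex of status `C` has at least two
neighbours of status `B`. -/
structure IsStatusLabeling {V : Type*} (G : SimpleGraph V) (S : V → Status) : Prop where
  unique_of_A : ∀ v, S v = A → ∃ b, S b = B ∧ G.Adj v b ∧ ∀ x, G.Adj v x → S x = B → x = b
  not_adj_of_B : ∀ v w, S v = B → G.Adj v w → S w ≠ B
  pair_of_B : ∀ v, S v = B → ∃ x y, x ≠ y ∧ S x = A ∧ S y = A ∧ G.Adj v x ∧ G.Adj v y ∧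
    ∀ w, G.Adj v w → S w = A → w = x ∨ w = y
  pair_of_C : ∀ v, S v = C → ∃ x y, x ≠ y ∧ S x = B ∧ S y = B ∧ G.Adj v x ∧ G.Adj v y

theorem IsStatusLabeling.of_iso {V W : Type*} {G : SimpleGraph V} {H : SimpleGraph W}
    {S : W → Status} (h : IsStatusLabeling H S) (e : G ≃g H) :
    IsStatusLabeling G (S ∘ e) where
  unique_of_A v hv := by
    obtain ⟨b, hb, hadj, huni⟩ := h.unique_of_A _ hv
    refine ⟨e.symm b, by simpa using hb, by rw [← e.map_adj_iff]; simpa using hadj, ?_⟩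
    intro x hx hxB
    rw [← huni (e x) (e.map_adj_iff.2 hx) hxB]
    simp
  not_adj_of_B v w hv hvw := h.not_adj_of_B _ _ hv (e.map_adj_iff.2 hvw)
  pair_of_B v hv := by
    obtain ⟨x, y, hxy, hx, hy, hvx, hvy, huni⟩ := h.pair_of_B _ hv
    refine ⟨e.symm x, e.symm y, by simpa using hxy, by simpa using hx, by simpa using hy,
      by rw [← e.map_adj_iff]; simpa using hvx, by rw [← e.map_adj_iff]; simpa using hvy, ?_⟩
    intro w hw hwA
    refine (huni (e w) (e.map_adj_iff.2 hw) hwA).imp ?_ ?_ <;>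
    · intro h
      simp [← h]
  pair_of_C v hv := by
    obtain ⟨x, y, hxy, hx, hy, hvx, hvy⟩ := h.pair_of_C _ hv
    exact ⟨e.symm x, e.symm y, by simpa using hxy, by simpa using hx, by simpa using hy,
      by rw [← e.map_adj_iff]; simpa using hvx, by rw [← e.map_adj_iff]; simpa using hvy⟩

section Characterization

variable {V : Type*} [DecidableEq V] {G : SimpleGraph V} {S : V → Status} {B' : Finset V}

theorem IsStatusLabeling.isRDF_twice (h : IsStatusLabeling G S)
    (hB : ∀ v, v ∈ B' ↔ S v = B) : IsRDF G (twice B') := by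
  intro v hv
  rw [twice_eq_zero, hB] at hv
  rcases hS : S v with _ | _ | _
  · obtain ⟨b, hb, hadj, -⟩ := h.unique_of_A v hS
    exact ⟨b, hadj, by rwa [twice_eq_two, hB]⟩
  · exact absurd hS hv
  · obtain ⟨x, -, -, hx, -, hadj, -⟩ := h.pair_of_C v hS
    exact ⟨x, hadj, by rwa [twice_eq_two, hB]⟩

variable [Fintype V]

/-- If `twice` of the vertices of status `B` is the only Roman dominating function of at most
its weight, then the graph is in the class: for a vertex `v` of status `B` the value `2` of `v`
can be moved in halves to its two neighbours of status `A`. -/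
theorem IsStatusLabeling.inRUVR (h : IsStatusLabeling G S) (hB : ∀ v, v ∈ B' ↔ S v = B)
    (huniq : ∀ g, IsRDF G g → g = twice B' ∨ 2 * #B' < weight g) : InRUVR G := by
  have hrdf := h.isRDF_twice hB
  have hnum : romanNumber G = 2 * #B' := by
    refine le_antisymm (weight_twice B' ▸ romanNumber_le hrdf) ?_
    obtain ⟨g, hg, hw⟩ := exists_isRDF_weight_eq G
    rcases huniq g hg with rfl | hlt
    · rw [← hw, weight_twice]
    · omega
  refine inRUVR_of_forall (fun f hf hw v => ?_) fun v => ?_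
  · rcases huniq f hf with rfl | hlt
    · unfold twice
      split_ifs <;> decide
    · omega
  · by_cases hv : S v = B
    · obtain ⟨x, y, hxy, hxA, hyA, hvx, hvy, huni⟩ := h.pair_of_B v hv
      have hvB : v ∈ B' := (hB v).2 hv
      have hxB : x ∉ B' := by simp [hB, hxA]
      have hyB : y ∉ B' := by simp [hB, hyA]
      have hnot : ∀ w ∈ ({x, y} : Finset V), w ∉ B'.erase v := by
        simp [hxB, hyB]
      let g : V → Fin 3 := fun w =>
        if w ∈ B'.erase v then 2 else if w ∈ ({x, y} : Finset V) then 1 else 0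
      have hg2 : ∀ w, w ∈ B' → w ≠ v → g w = 2 := fun w hw hwv => by
        simp only [g, mem_erase.2 ⟨hwv, hw⟩, if_true]
      refine ⟨g, ⟨?_, fun w hwv hw0 => ?_⟩, ?_⟩
      · have h1 : v ∉ B'.erase v := by simp
        have h2 : v ∉ ({x, y} : Finset V) := by simp [hvx.ne, hvy.ne]
        simp only [g, h1, h2, if_false]
      · have hwB : w ∉ B' := fun hw => by
          rw [hg2 w hw hwv] at hw0
          simp at hw0
        have hwxy : ¬ (w = x ∨ w = y) := fun hw => by
          have h1 : w ∈ ({x, y} : Finset V) := by simpa using hw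
          simp only [g, h1, hnot w h1, if_true, if_false] at hw0
          simp at hw0
        rcases hS : S w with _ | _ | _
        · obtain ⟨b, hb, hadj, -⟩ := h.unique_of_A w hS
          refine ⟨b, hadj, hg2 b ((hB b).2 hb) ?_⟩
          rintro rfl
          exact hwxy (huni w hadj.symm hS)
        · exact absurd ((hB w).2 hS) hwB
        · obtain ⟨p, q, hpq, hp, hq, hwp, hwq⟩ := h.pair_of_C w hS
          by_cases hpv : p = v
          · exact ⟨q, hwq, hg2 q ((hB q).2 hq) fun hqv => hpq (hpv.trans hqv.symm)⟩
          · exact ⟨p, hwp, hg2 p ((hB p).2 hp) hpv⟩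
      · have hval (w : V) : ((g w : Fin 3) : ℕ) =
            (if w ∈ B'.erase v then 2 else 0) + (if w ∈ ({x, y} : Finset V) then 1 else 0) := by
          have := hnot w
          by_cases h1 : w ∈ ({x, y} : Finset V)
          · simp only [g, h1, this h1]; rfl
          · by_cases h2 : w ∈ B'.erase v <;> simp only [g, h1, h2] <;> rfl
        have := card_erase_add_one hvB
        simp only [weight, hval, sum_add_distrib]
        rw [← sum_filter, ← sum_filter, filter_univ_mem, filter_univ_mem, sum_const, sum_const,
          card_pair hxy, hnum, smul_eq_mul, smul_eq_mul]
        omega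
    · refine ⟨twice B', ⟨by rwa [twice_eq_zero, hB], fun w _ => hrdf w⟩, ?_⟩
      rw [weight_twice, hnum]

theorem IsStatusLabeling.inRUVR_of_isAcyclic (h : IsStatusLabeling G S) (hG : G.IsAcyclic) :
    InRUVR G := by
  classical
  set B' : Finset V := {v | S v = B} with hB'
  have hB : ∀ v, v ∈ B' ↔ S v = B := fun v => by simp [hB']
  refine h.inRUVR hB fun g hg => eq_twice_or_lt_weight hG B' (privateNbrs G B')
    (fun _ _ => subset_rfl) (fun b hb => ?_) g fun b _ v _ => hg v
  rw [hB] at hb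
  obtain ⟨x, y, hxy, hxA, hyA, hbx, hby, -⟩ := h.pair_of_B b hb
  have hpriv : ∀ w, S w = A → G.Adj b w → w ∈ privateNbrs G B' b := by
    intro w hw hadj
    obtain ⟨c, -, -, huni⟩ := h.unique_of_A w hw
    refine mem_privateNbrs.2 ⟨.inr hadj.symm, fun z hz hzb => ⟨?_, fun hwz => hzb ?_⟩⟩
    · rintro rfl
      simp [hB, hw] at hz
    · rw [huni z hwz ((hB z).1 hz), huni b hadj.symm hb]
  have hsub : ({b, x, y} : Finset V) ⊆ privateNbrs G B' b := by
    intro w hw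
    simp only [mem_insert, mem_singleton] at hw
    rcases hw with rfl | rfl | rfl
    · exact mem_privateNbrs.2 ⟨.inl rfl, fun z hz hzb =>
        ⟨hzb.symm, fun hadj => h.not_adj_of_B w z hb hadj ((hB z).1 hz)⟩⟩
    · exact hpriv w hxA hbx
    · exact hpriv w hyA hby
  rw [← card_eq_three.2 ⟨b, x, y, hbx.ne, hby.ne, hxy, rfl⟩]
  exact card_le_card hsub

/-- If each `b ∈ B'` has at least three closed private neighbours, fewer than three of them other
than `b`, then `b` is one of them. So the vertices with status `B` on `B'`, status `A` outside of
`B'` if they have exactly one neighbour in `B'`, and status `C` otherwise, satisfy the conditions. -/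
theorem exists_isStatusLabeling (hrdf : IsRDF G (twice B'))
    (h3 : ∀ b ∈ B', 3 ≤ #(privateNbrs G B' b))
    (hlt : ∀ b ∈ B', #((privateNbrs G B' b).erase b) < 3) :
    ∃ S, IsStatusLabeling G S ∧ ∀ v, v ∈ B' ↔ S v = B := by
  classical
  have hself : ∀ b ∈ B', b ∈ privateNbrs G B' b := by
    intro b hb
    by_contra h
    have h1 := hlt b hb
    rw [erase_eq_of_notMem h] at h1
    exact absurd (h3 b hb) (by omega)
  have htwo : ∀ b ∈ B', #((privateNbrs G B' b).erase b) = 2 := by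
    intro b hb
    have h1 := hlt b hb
    have h2 := h3 b hb
    have h3 := card_erase_add_one (hself b hb)
    omega
  let S : V → Status := fun v =>
    if v ∈ B' then B else if ∃ b ∈ B', v ∈ privateNbrs G B' b then A else C
  have hSB : ∀ v, S v = B ↔ v ∈ B' := by
    intro v
    simp only [S]
    split_ifs <;> simp_all
  have hSA : ∀ v, S v = A ↔ v ∉ B' ∧ ∃ b ∈ B', v ∈ privateNbrs G B' b := by
    intro v
    simp only [S]
    split_ifs <;> simp_all
  have hSC : ∀ v, S v = C ↔ v ∉ B' ∧ ¬ ∃ b ∈ B', v ∈ privateNbrs G B' b := by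
    intro v
    simp only [S]
    split_ifs <;> simp_all
  refine ⟨S, ⟨fun v hv => ?_, fun v w hv hvw hw => ?_, fun v hv => ?_, fun v hv => ?_⟩,
    fun v => (hSB v).symm⟩
  · obtain ⟨hvB, b, hb, hvb⟩ := (hSA v).1 hv
    rw [mem_privateNbrs] at hvb
    have hne : v ≠ b := fun h => hvB (h ▸ hb)
    refine ⟨b, (hSB b).2 hb, hvb.1.resolve_left hne, fun x hx hxB => ?_⟩
    by_contra hxb
    exact (hvb.2 x ((hSB x).1 hxB) hxb).2 hx
  · rw [hSB] at hv hw
    exact ((mem_privateNbrs.1 (hself v hv)).2 w hw hvw.ne').2 hvw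
  · rw [hSB] at hv
    obtain ⟨x, y, hxy, heq⟩ := card_eq_two.1 (htwo v hv)
    have hmem : ∀ w, w ∈ (privateNbrs G B' v).erase v ↔ G.Adj v w ∧ S w = A := by
      intro w
      rw [mem_erase, hSA]
      refine ⟨fun ⟨hne, hw⟩ => ?_, fun ⟨hadj, hwB, b, hb, hwb⟩ => ⟨hadj.ne', ?_⟩⟩
      · have hw' := mem_privateNbrs.1 hw
        exact ⟨(hw'.1.resolve_left hne).symm, fun hwB => (hw'.2 w hwB hne).1 rfl, v, hv, hw⟩
      · by_cases hvb : v = b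
        · rwa [hvb]
        · exact absurd hadj.symm ((mem_privateNbrs.1 hwb).2 v hv hvb).2
    have hx := (hmem x).1 (by rw [heq]; simp)
    have hy := (hmem y).1 (by rw [heq]; simp)
    refine ⟨x, y, hxy, hx.2, hy.2, hx.1, hy.1, fun w hw hwA => ?_⟩
    have := (hmem w).2 ⟨hw, hwA⟩
    rw [heq] at this
    simpa using this
  · obtain ⟨hvB, hno⟩ := (hSC v).1 hv
    obtain ⟨b, hadj, hb⟩ := hrdf v (twice_eq_zero.2 hvB)
    rw [twice_eq_two] at hb
    have hvb : v ∉ privateNbrs G B' b := fun h => hno ⟨b, hb, h⟩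
    rw [mem_privateNbrs] at hvb
    push Not at hvb
    obtain ⟨x, hx, hxb, himp⟩ := hvb (.inr hadj)
    exact ⟨b, x, hxb.symm, (hSB b).2 hb, (hSB x).2 hx, hadj, himp fun h => hvB (h ▸ hx)⟩

/-- In a forest of the class, three neighbours of `b` that are private to `b` would contradict
the counting lemma, applied to a Roman dominating function of `G - b`. -/
theorem InRUVR.exists_isStatusLabeling (hG : InRUVR G) (hac : G.IsAcyclic) :
    ∃ S, IsStatusLabeling G S := by
  obtain ⟨B', hrdf, hnum, h3⟩ := hG.exists_twice
  have hlt : ∀ b ∈ B', #((privateNbrs G B' b).erase b) < 3 := by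
    intro b hb
    by_contra! hge
    obtain ⟨g, ⟨hgb, hg⟩, hw⟩ := hG.exists_isRDFOff b
    have := eq_twice_or_lt_weight hac B'
      (fun x => if x = b then (privateNbrs G B' b).erase b else privateNbrs G B' x)
      (fun x _ => ?_) (fun x hx => ?_) g fun x hx v hv h0 => hg v ?_ h0
    · rcases this with rfl | h
      · exact twice_eq_zero.1 hgb hb
      · omega
    · split_ifs with h
      · exact h ▸ erase_subset _ _
      · exact subset_rfl
    · split_ifs
      · exact hge
      · exact h3 x hx
    · split_ifs at hv with h
      · exact ne_of_mem_erase hv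
      · exact ((mem_privateNbrs.1 hv).2 b hb fun hbx => h hbx.symm).1
  obtain ⟨S, hS, -⟩ := RomanUVR.exists_isStatusLabeling hrdf h3 hlt
  exact ⟨S, hS⟩

end Characterization

/-! ### The trees of the family have status labelings -/

instance : DecidableEq Status
  | A, A => isTrue rfl
  | A, B => isFalse nofun
  | A, C => isFalse nofun
  | B, A => isFalse nofun
  | B, B => isTrue rfl
  | B, C => isFalse nofun
  | C, A => isFalse nofun
  | C, B => isFalse nofun
  | C, C => isTrue rfl

section Attach

variable {V W : Type*} {G : SimpleGraph V} {H : SimpleGraph W} {u : V} {x : W}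

@[simp] theorem attach_adj_inl_inl {a b : V} :
    (attach G u H x).Adj (.inl a) (.inl b) ↔ G.Adj a b := by
  simp [attach, SimpleGraph.edge_adj]

@[simp] theorem attach_adj_inr_inr {a b : W} :
    (attach G u H x).Adj (.inr a) (.inr b) ↔ H.Adj a b := by
  simp [attach, SimpleGraph.edge_adj]

@[simp] theorem attach_adj_inl_inr {a : V} {b : W} :
    (attach G u H x).Adj (.inl a) (.inr b) ↔ a = u ∧ b = x := by
  simp [attach, SimpleGraph.edge_adj]

@[simp] theorem attach_adj_inr_inl {a : V} {b : W} :
    (attach G u H x).Adj (.inr b) (.inl a) ↔ a = u ∧ b = x := by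
  rw [SimpleGraph.adj_comm, attach_adj_inl_inr]

theorem isTree_attach [Finite V] [Finite W] (hG : G.IsTree) (hH : H.IsTree) :
    (attach G u H x).IsTree := by
  rw [SimpleGraph.isTree_iff_connected_and_card]
  have hconn : (attach G u H x).Connected := hG.connected.sum_sup_edge hH.connected
  refine ⟨hconn, le_antisymm ?_ hconn.card_vert_le_card_edgeSet_add_one⟩
  have h1 := (SimpleGraph.isTree_iff_connected_and_card.1 hG).2
  have h2 := (SimpleGraph.isTree_iff_connected_and_card.1 hH).2
  have h3 : Nat.card (attach G u H x).edgeSet ≤ Nat.card (G ⊕g H).edgeSet + 1 := by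
    simp only [Nat.card_coe_set_eq]
    rw [attach, SimpleGraph.edgeSet_sup]
    refine (Set.ncard_union_le _ _).trans (Nat.add_le_add_left ?_ _)
    refine (Set.ncard_le_ncard (SimpleGraph.edgeSet_edge_of_ne Sum.inl_ne_inr).le).trans ?_
    simp
  rw [Nat.card_congr SimpleGraph.edgeSetSumEquiv, Nat.card_sum] at h3
  rw [Nat.card_sum]
  omega

/-- Joining by an edge preserves status labelings if the statuses at the ends do not conflict.
In the second graph `x` may be a vertex of status `C` for which one neighbour of status `B` is
missing, if the new neighbour `u` has status `B`. -/
theorem isStatusLabeling_attach {S : V → Status} {S' : W → Status} (h : IsStatusLabeling G S)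
    (hA : ∀ v, S' v = A → ∃ b, S' b = B ∧ H.Adj v b ∧ ∀ x, H.Adj v x → S' x = B → x = b)
    (hB : ∀ v w, S' v = B → H.Adj v w → S' w ≠ B)
    (hBA : ∀ v, S' v = B → ∃ x y, x ≠ y ∧ S' x = A ∧ S' y = A ∧ H.Adj v x ∧ H.Adj v y ∧
      ∀ w, H.Adj v w → S' w = A → w = x ∨ w = y)
    (hC : ∀ v, S' v = C → (∃ x y, x ≠ y ∧ S' x = B ∧ S' y = B ∧ H.Adj v x ∧ H.Adj v y) ∨
      (v = x ∧ S u = B ∧ ∃ y, S' y = B ∧ H.Adj v y))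
    (h1 : S u = B → S' x = C) (h2 : S' x = B → S u = C) :
    IsStatusLabeling (attach G u H x) (Sum.elim S S') where
  unique_of_A := by
    rintro (v | v) hv
    · simp only [Sum.elim_inl] at hv
      obtain ⟨b, hb, hadj, huni⟩ := h.unique_of_A v hv
      refine ⟨.inl b, hb, by simpa using hadj, ?_⟩
      rintro (y | y) hy hyB
      · rw [huni y (by simpa using hy) hyB]
      · simp only [attach_adj_inl_inr] at hy
        obtain ⟨rfl, rfl⟩ := hy
        exact absurd (h2 hyB) (by simp [hv])
    · simp only [Sum.elim_inr] at hv
      obtain ⟨b, hb, hadj, huni⟩ := hA v hv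
      refine ⟨.inr b, hb, by simpa using hadj, ?_⟩
      rintro (y | y) hy hyB
      · simp only [attach_adj_inr_inl] at hy
        obtain ⟨rfl, rfl⟩ := hy
        exact absurd (h1 hyB) (by simp [hv])
      · rw [huni y (by simpa using hy) hyB]
  not_adj_of_B := by
    rintro (v | v) (w | w) hv hvw hw
    · exact h.not_adj_of_B v w hv (by simpa using hvw) hw
    · simp only [attach_adj_inl_inr] at hvw
      obtain ⟨rfl, rfl⟩ := hvw
      simp only [Sum.elim_inl, Sum.elim_inr] at hv hw
      simp [h1 hv] at hw
    · simp only [attach_adj_inr_inl] at hvw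
      obtain ⟨rfl, rfl⟩ := hvw
      simp only [Sum.elim_inl, Sum.elim_inr] at hv hw
      simp [h1 hw] at hv
    · exact hB v w hv (by simpa using hvw) hw
  pair_of_B := by
    rintro (v | v) hv
    · obtain ⟨p, q, hpq, hp, hq, hvp, hvq, huni⟩ := h.pair_of_B v hv
      refine ⟨.inl p, .inl q, by simpa using hpq, hp, hq, by simpa using hvp, by simpa using hvq, ?_⟩
      rintro (w | w) hw hwA
      · simpa using huni w (by simpa using hw) hwA
      · simp only [attach_adj_inl_inr] at hw
        obtain ⟨rfl, rfl⟩ := hw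
        simp only [Sum.elim_inl, Sum.elim_inr] at hv hwA
        simp [h1 hv] at hwA
    · obtain ⟨p, q, hpq, hp, hq, hvp, hvq, huni⟩ := hBA v hv
      refine ⟨.inr p, .inr q, by simpa using hpq, hp, hq, by simpa using hvp, by simpa using hvq, ?_⟩
      rintro (w | w) hw hwA
      · simp only [attach_adj_inr_inl] at hw
        obtain ⟨rfl, rfl⟩ := hw
        simp only [Sum.elim_inl, Sum.elim_inr] at hv hwA
        simp [h2 hv] at hwA
      · simpa using huni w (by simpa using hw) hwA
  pair_of_C := by
    rintro (v | v) hv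
    · obtain ⟨p, q, hpq, hp, hq, hvp, hvq⟩ := h.pair_of_C v hv
      exact ⟨.inl p, .inl q, by simpa using hpq, hp, hq, by simpa using hvp, by simpa using hvq⟩
    · rcases hC v hv with ⟨p, q, hpq, hp, hq, hvp, hvq⟩ | ⟨rfl, hu, y, hy, hvy⟩
      · exact ⟨.inr p, .inr q, by simpa using hpq, hp, hq, by simpa using hvp, by simpa using hvq⟩
      · exact ⟨.inl u, .inr y, by simp, hu, hy, by simp, by simpa using hvy⟩

theorem IsStatusLabeling.attach {S : V → Status} {S' : W → Status} (h : IsStatusLabeling G S)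
    (h' : IsStatusLabeling H S') (h1 : S u = B → S' x = C) (h2 : S' x = B → S u = C) :
    IsStatusLabeling (attach G u H x) (Sum.elim S S') :=
  isStatusLabeling_attach h h'.unique_of_A h'.not_adj_of_B h'.pair_of_B
    (fun v hv => .inl (h'.pair_of_C v hv)) h1 h2

end Attach

theorem pathGraph_three_eq : SimpleGraph.pathGraph 3 = SimpleGraph.starGraph 1 := by
  ext a b
  simp only [SimpleGraph.pathGraph_adj, SimpleGraph.starGraph_adj]
  fin_cases a <;> fin_cases b <;> simp

theorem isTree_pathGraph_three : (SimpleGraph.pathGraph 3).IsTree :=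
  pathGraph_three_eq ▸ SimpleGraph.isTree_starGraph 1

theorem isTree_star3 : star3.IsTree := SimpleGraph.isTree_starGraph 1

instance : DecidableRel star3.Adj :=
  inferInstanceAs (DecidableRel (SimpleGraph.starGraph (1 : Fin 4)).Adj)

theorem isStatusLabeling_path : IsStatusLabeling (SimpleGraph.pathGraph 3) pathLabel := by
  rw [pathGraph_three_eq]
  constructor <;> decide

theorem IsStatusLabeling.attach_star3 {V : Type*} {G : SimpleGraph V} {S : V → Status}
    (h : IsStatusLabeling G S) {u : V} (hu : S u = B) :
    IsStatusLabeling (RomanUVR.attach G u star3 0) (Sum.elim S star3Label) := by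
  refine isStatusLabeling_attach h (by decide) (by decide) (by decide) (fun v hv => ?_)
    (fun _ => rfl) (fun h => absurd h (by decide))
  have h0 : ∀ v, star3Label v = C → v = 0 := by decide
  obtain rfl := h0 v hv
  exact .inr ⟨rfl, hu, 1, rfl, by decide⟩

theorem isTree_treeR : treeR.IsTree := isTree_attach isTree_pathGraph_three isTree_star3

theorem isStatusLabeling_treeR : IsStatusLabeling treeR treeRLabel :=
  isStatusLabeling_path.attach_star3 rfl

theorem LabeledFamily.finite {V : Type} {T : SimpleGraph V} {S : V → Status}
    (h : LabeledFamily V T S) : Finite V := by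
  induction h <;> infer_instance

theorem LabeledFamily.isTree {V : Type} {T : SimpleGraph V} {S : V → Status}
    (h : LabeledFamily V T S) : T.IsTree := by
  induction h with
  | base => exact isTree_pathGraph_three
  | op1 h _ _ ih => have := h.finite; exact isTree_attach ih isTree_pathGraph_three
  | op2 h _ _ ih => have := h.finite; exact isTree_attach ih isTree_star3
  | op3 h _ _ ih => have := h.finite; exact isTree_attach ih isTree_pathGraph_three
  | op4 h _ _ ih => have := h.finite; exact isTree_attach ih isTree_treeR

theorem LabeledFamily.isStatusLabeling {V : Type} {T : SimpleGraph V} {S : V → Status}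
    (h : LabeledFamily V T S) : IsStatusLabeling T S := by
  induction h with
  | base => exact isStatusLabeling_path
  | op1 _ u hu ih =>
    exact ih.attach isStatusLabeling_path (fun h => by simp [h] at hu)
      (fun h => absurd h (by decide))
  | op2 _ u hu ih => exact ih.attach_star3 hu
  | op3 _ u hu ih =>
    exact ih.attach isStatusLabeling_path (fun h => by simp [h] at hu) (fun _ => hu)
  | op4 _ u hu ih =>
    exact ih.attach isStatusLabeling_treeR (fun h => by simp [h] at hu)
      (fun h => absurd h (by decide))

theorem LabeledFamily.card_eq {V : Type} {T : SimpleGraph V} {S : V → Status}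
    (h : LabeledFamily V T S) : ∃ a b, Nat.card V = 3 + 3 * a + 4 * b := by
  induction h with
  | base => exact ⟨0, 0, by simp⟩
  | op1 h _ _ ih | op3 h _ _ ih =>
    have := h.finite
    obtain ⟨a, b, hab⟩ := ih
    exact ⟨a + 1, b, by rw [Nat.card_sum, hab, Nat.card_fin]; ring⟩
  | op2 h _ _ ih =>
    have := h.finite
    obtain ⟨a, b, hab⟩ := ih
    exact ⟨a, b + 1, by rw [Nat.card_sum, hab, Nat.card_fin]; ring⟩
  | op4 h _ _ ih =>
    have := h.finite
    obtain ⟨a, b, hab⟩ := ih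
    exact ⟨a + 1, b + 1, by rw [Nat.card_sum, Nat.card_sum, hab, Nat.card_fin, Nat.card_fin]; ring⟩

/-- Operations `op1` and `op2`, repeated at a vertex of status `A` and one of status `B`,
reach all the orders that are allowed by `LabeledFamily.card_eq`. -/
theorem exists_labeledFamily_card_eq (a b : ℕ) : ∃ (V : Type) (T : SimpleGraph V) (S : V → Status),
    LabeledFamily V T S ∧ (∃ u, S u = A) ∧ (∃ u, S u = B) ∧ Nat.card V = 3 + 3 * a + 4 * b := by
  induction a with
  | zero =>
    induction b with
    | zero => exact ⟨_, _, _, .base, ⟨0, rfl⟩, ⟨1, rfl⟩, by simp⟩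
    | succ b ih =>
      obtain ⟨V, T, S, h, ⟨u, hu⟩, ⟨v, hv⟩, hc⟩ := ih
      have := h.finite
      exact ⟨_, _, _, h.op2 v hv, ⟨.inl u, hu⟩, ⟨.inl v, hv⟩, by
        rw [Nat.card_sum, hc, Nat.card_fin]; ring⟩
  | succ a ih =>
    obtain ⟨V, T, S, h, ⟨u, hu⟩, ⟨v, hv⟩, hc⟩ := ih
    have := h.finite
    exact ⟨_, _, _, h.op1 u (.inl hu), ⟨.inl u, hu⟩, ⟨.inl v, hv⟩, by
      rw [Nat.card_sum, hc, Nat.card_fin]; ring⟩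

/-! ### Trees with a status labeling belong to the family -/

section Growth

variable {V W W' : Type*} {G : SimpleGraph V} {T : SimpleGraph W} {H : SimpleGraph W'}

/-- Two disjoint connected subgraphs of a forest are joined by at most one edge. -/
theorem eq_of_adj_of_adj (hG : G.IsAcyclic) (φ : T ↪g G) (ψ : H ↪g G) (hT : T.Connected)
    (hH : H.Connected) (hdisj : ∀ a b, φ a ≠ ψ b) {u u' : W} {x x' : W'}
    (h : G.Adj (φ u) (ψ x)) (h' : G.Adj (φ u') (ψ x')) : u' = u ∧ x' = x := by
  by_contra hne
  have hbr := SimpleGraph.isAcyclic_iff_forall_adj_isBridge.1 hG h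
  rw [SimpleGraph.isBridge_iff] at hbr
  apply hbr
  have hφ : (G.deleteEdges {s(φ u, ψ x)}).Reachable (φ u) (φ u') := by
    refine (hT.preconnected u u').map (⟨φ, fun {a b} hab => ?_⟩ :
      T →g G.deleteEdges {s(φ u, ψ x)})
    rw [SimpleGraph.deleteEdges_adj]
    refine ⟨φ.map_adj_iff.2 hab, fun hmem => ?_⟩
    rcases Sym2.eq_iff.1 (Set.mem_singleton_iff.1 hmem) with hh | hh
    · exact hdisj _ _ hh.2
    · exact hdisj _ _ hh.1
  have hψ : (G.deleteEdges {s(φ u, ψ x)}).Reachable (ψ x') (ψ x) := by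
    refine (hH.preconnected x' x).map (⟨ψ, fun {a b} hab => ?_⟩ :
      H →g G.deleteEdges {s(φ u, ψ x)})
    rw [SimpleGraph.deleteEdges_adj]
    refine ⟨ψ.map_adj_iff.2 hab, fun hmem => ?_⟩
    rcases Sym2.eq_iff.1 (Set.mem_singleton_iff.1 hmem) with hh | hh
    · exact hdisj _ _ hh.1.symm
    · exact hdisj _ _ hh.2.symm
  refine hφ.trans (SimpleGraph.Reachable.trans (SimpleGraph.Adj.reachable ?_) hψ)
  rw [SimpleGraph.deleteEdges_adj]
  refine ⟨h', fun hmem => ?_⟩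
  rcases Sym2.eq_iff.1 (Set.mem_singleton_iff.1 hmem) with hh | hh
  · exact hne ⟨φ.injective hh.1, ψ.injective hh.2⟩
  · exact hdisj _ _ hh.1

theorem eq_of_adj_of_notMem_range (hG : G.IsAcyclic) (φ : T ↪g G) (hT : T.Connected) {x : V}
    (hx : x ∉ Set.range φ) {u u' : W} (h : G.Adj (φ u) x) (h' : G.Adj (φ u') x) : u' = u := by
  let ψ : (⊥ : SimpleGraph Unit) ↪g G := ⟨⟨fun _ => x, fun _ _ _ => rfl⟩, by simp⟩
  exact (eq_of_adj_of_adj hG φ ψ hT ⟨.of_subsingleton⟩ (fun a _ hab => hx ⟨a, hab⟩)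
    (x := ()) (x' := ()) h h').1

theorem exists_attach_embedding (hG : G.IsAcyclic) (φ : T ↪g G) (ψ : H ↪g G) (hT : T.Connected)
    (hH : H.Connected) (hdisj : ∀ a b, φ a ≠ ψ b) {u : W} {x : W'} (h : G.Adj (φ u) (ψ x)) :
    ∃ Φ : attach T u H x ↪g G, ⇑Φ = Sum.elim φ ψ := by
  have hcross : ∀ a b, G.Adj (φ a) (ψ b) ↔ a = u ∧ b = x := fun a b =>
    ⟨eq_of_adj_of_adj hG φ ψ hT hH hdisj h, by rintro ⟨rfl, rfl⟩; exact h⟩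
  refine ⟨⟨⟨Sum.elim φ ψ, φ.injective.sumElim ψ.injective hdisj⟩, ?_⟩, rfl⟩
  rintro (a | a) (b | b)
  · simp
  · simpa using hcross a b
  · simpa [G.adj_comm] using hcross b a
  · simp

/-- The embedding respects the labels, and its range is closed under the edges between vertices
of status `A` and vertices of status `B`. -/
structure IsClosedEmbedding (S : V → Status) (S' : W → Status) (φ : T ↪g G) : Prop where
  label : ∀ w, S (φ w) = S' w
  closed : ∀ w v, G.Adj (φ w) v → (S' w = A ∧ S v = B ∨ S' w = B ∧ S v = A) → v ∈ Set.range φ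

variable {S : V → Status} {S' : W → Status} {S'' : W' → Status}

theorem IsClosedEmbedding.disjoint {φ : T ↪g G} {ψ : H ↪g G} (hφ : IsClosedEmbedding S S' φ)
    (hψ : IsClosedEmbedding S S'' ψ) (hH : ∀ v, S'' v = A → ∃ b, S'' b = B ∧ H.Adj v b)
    (h : ∀ v, S'' v ≠ A → ψ v ∉ Set.range φ) : ∀ a b, φ a ≠ ψ b := by
  intro a v hav
  by_cases hv : S'' v = A
  · obtain ⟨b, hb, hadj⟩ := hH v hv
    refine h b (by simp [hb]) (hφ.closed a (ψ b) ?_ (.inl ⟨?_, ?_⟩))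
    · rw [hav]; exact ψ.map_adj_iff.2 hadj
    · rw [← hφ.label, hav, hψ.label, hv]
    · rw [hψ.label, hb]
  · exact h v hv ⟨a, hav⟩

theorem IsClosedEmbedding.attach (hG : G.IsAcyclic) {φ : T ↪g G} {ψ : H ↪g G}
    (hφ : IsClosedEmbedding S S' φ) (hψ : IsClosedEmbedding S S'' ψ) (hT : T.Connected)
    (hH : H.Connected) (hHA : ∀ v, S'' v = A → ∃ b, S'' b = B ∧ H.Adj v b)
    (h : ∀ v, S'' v ≠ A → ψ v ∉ Set.range φ) {u : W} {x : W'} (hux : G.Adj (φ u) (ψ x)) :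
    ∃ Φ : RomanUVR.attach T u H x ↪g G,
      IsClosedEmbedding S (Sum.elim S' S'') Φ ∧ ⇑Φ = Sum.elim φ ψ := by
  obtain ⟨Φ, hΦ⟩ := exists_attach_embedding hG φ ψ hT hH (hφ.disjoint hψ hHA h) hux
  refine ⟨Φ, ⟨?_, ?_⟩, hΦ⟩
  · rintro (w | w)
    · simpa [hΦ] using hφ.label w
    · simpa [hΦ] using hψ.label w
  · rintro (w | w) v hadj hlab
    · obtain ⟨z, hz⟩ := hφ.closed w v (by simpa [hΦ] using hadj) hlab
      exact ⟨.inl z, by simpa [hΦ] using hz⟩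
    · obtain ⟨z, hz⟩ := hψ.closed w v (by simpa [hΦ] using hadj) hlab
      exact ⟨.inr z, by simpa [hΦ] using hz⟩

/-- An injective map from a star into a forest that respects the edges at the center is an
embedding. -/
theorem exists_starGraph_embedding [DecidableEq W] (hG : G.IsAcyclic) (r : W) (f : W → V)
    (hf : Function.Injective f) (hadj : ∀ w, w ≠ r → G.Adj (f r) (f w)) :
    ∃ ψ : SimpleGraph.starGraph r ↪g G, ⇑ψ = f := by
  refine ⟨⟨⟨f, hf⟩, ?_⟩, rfl⟩
  intro a b
  simp only [Function.Embedding.coeFn_mk, SimpleGraph.starGraph_adj]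
  constructor
  · intro h
    refine ⟨fun hab => h.ne (congrArg f hab), ?_⟩
    by_contra! hab
    exact not_adj_of_isAcyclic hG (hadj a hab.1) (hadj b hab.2) h
  · rintro ⟨hne, rfl | rfl⟩
    · exact hadj b hne.symm
    · exact (hadj a hne).symm

theorem IsStatusLabeling.exists_path_embedding (h : IsStatusLabeling G S) (hG : G.IsAcyclic)
    {b x : V} (hb : S b = B) (hx : S x = A) (hbx : G.Adj b x) :
    ∃ ψ : SimpleGraph.pathGraph 3 ↪g G, IsClosedEmbedding S pathLabel ψ ∧ ψ 0 = x ∧ ψ 1 = b := by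
  obtain ⟨y, hy, hby, hxy, huni⟩ : ∃ y, S y = A ∧ G.Adj b y ∧ x ≠ y ∧
      ∀ w, G.Adj b w → S w = A → w = x ∨ w = y := by
    obtain ⟨p, q, hpq, hp, hq, hbp, hbq, huni⟩ := h.pair_of_B b hb
    rcases huni x hbx hx with rfl | rfl
    · exact ⟨q, hq, hbq, hpq, huni⟩
    · exact ⟨p, hp, hbp, hpq.symm, fun w hw hwA => (huni w hw hwA).symm⟩
  rw [pathGraph_three_eq]
  obtain ⟨ψ, hψ⟩ := exists_starGraph_embedding hG (1 : Fin 3) ![x, b, y] (by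
      intro i j
      have := hbx.ne
      have := hby.ne
      fin_cases i <;> fin_cases j <;> simp <;> tauto) (by
      intro w
      fin_cases w <;> simp [hbx, hby])
  have h0 : ψ 0 = x := by simp [hψ]
  have h1 : ψ 1 = b := by simp [hψ]
  have h2 : ψ 2 = y := by simp [hψ]
  have hA : ∀ v w, S v = A → G.Adj b v → G.Adj v w → S w = B → w = b := by
    intro v w hv hbv hvw hw
    obtain ⟨c, -, -, hc⟩ := h.unique_of_A v hv
    rw [hc w hvw hw, hc b hbv.symm hb]
  refine ⟨ψ, ⟨?_, ?_⟩, h0, h1⟩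
  · intro w
    fin_cases w
    · exact h0 ▸ hx
    · exact h1 ▸ hb
    · exact h2 ▸ hy
  · intro w v hadj hlab
    have key : ∀ z, S z = A → G.Adj b z → G.Adj z v → S v = B → v ∈ Set.range ψ :=
      fun z hz hbz hzv hv => ⟨1, by rw [h1, hA z v hz hbz hzv hv]⟩
    fin_cases w
    · exact key x hx hbx (h0 ▸ hadj) (by simpa [pathLabel] using hlab)
    · rcases huni v (h1 ▸ hadj) (by simpa [pathLabel] using hlab) with rfl | rfl
      · exact ⟨0, h0⟩
      · exact ⟨2, h2⟩
    · exact key y hy hby (h2 ▸ hadj) (by simpa [pathLabel] using hlab)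

theorem IsStatusLabeling.exists_star3_embedding (h : IsStatusLabeling G S) (hG : G.IsAcyclic)
    {b c : V} (hb : S b = B) (hc : S c = C) (hbc : G.Adj b c) :
    ∃ ψ : star3 ↪g G, IsClosedEmbedding S star3Label ψ ∧ ψ 0 = c ∧ ψ 1 = b := by
  obtain ⟨x, y, hxy, hx, hy, hbx, hby, huni⟩ := h.pair_of_B b hb
  have hcx : c ≠ x := fun h => by simp [← h, hc] at hx
  have hcy : c ≠ y := fun h => by simp [← h, hc] at hy
  obtain ⟨ψ, hψ⟩ := exists_starGraph_embedding hG (1 : Fin 4) ![c, b, x, y] (by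
      intro i j
      have := hbx.ne
      have := hby.ne
      have := hbc.ne
      fin_cases i <;> fin_cases j <;> simp <;> tauto) (by
      intro w
      fin_cases w <;> simp [hbx, hby, hbc])
  have h0 : ψ 0 = c := by simp [hψ]
  have h1 : ψ 1 = b := by simp [hψ]
  have h2 : ψ 2 = x := by simp [hψ]
  have h3 : ψ 3 = y := by simp [hψ]
  have hA : ∀ v w, S v = A → G.Adj b v → G.Adj v w → S w = B → w = b := by
    intro v w hv hbv hvw hw
    obtain ⟨c, -, -, hc⟩ := h.unique_of_A v hv
    rw [hc w hvw hw, hc b hbv.symm hb]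
  refine ⟨ψ, ⟨?_, ?_⟩, h0, h1⟩
  · intro w
    fin_cases w
    · exact h0 ▸ hc
    · exact h1 ▸ hb
    · exact h2 ▸ hx
    · exact h3 ▸ hy
  · intro w v hadj hlab
    have key : ∀ z, S z = A → G.Adj b z → G.Adj z v → S v = B → v ∈ Set.range ψ :=
      fun z hz hbz hzv hv => ⟨1, by rw [h1, hA z v hz hbz hzv hv]⟩
    fin_cases w
    · simp [star3Label] at hlab
    · rcases huni v (h1 ▸ hadj) (by simpa [star3Label] using hlab) with rfl | rfl
      · exact ⟨2, h2⟩
      · exact ⟨3, h3⟩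
    · exact key x hx hbx (h2 ▸ hadj) (by simpa [star3Label] using hlab)
    · exact key y hy hby (h3 ▸ hadj) (by simpa [star3Label] using hlab)

theorem exists_B_adj_path : ∀ v, pathLabel v = A →
    ∃ b, pathLabel b = B ∧ (SimpleGraph.pathGraph 3).Adj v b := by
  rw [pathGraph_three_eq]
  decide

theorem exists_B_adj_star3 : ∀ v, star3Label v = A → ∃ b, star3Label b = B ∧ star3.Adj v b := by
  decide

theorem exists_B_adj_treeR : ∀ v, treeRLabel v = A → ∃ b, treeRLabel b = B ∧ treeR.Adj v b := by
  intro v hv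
  obtain ⟨b, hb, hadj, -⟩ := isStatusLabeling_treeR.unique_of_A v hv
  exact ⟨b, hb, hadj⟩

/-- Two neighbours of status `B` of a vertex of status `C` span a copy of the tree `R`. -/
theorem IsStatusLabeling.exists_treeR_embedding (h : IsStatusLabeling G S) (hG : G.IsAcyclic)
    {b b' c : V} (hne : b ≠ b') (hb : S b = B) (hb' : S b' = B) (hc : S c = C) (hbc : G.Adj b c)
    (hbc' : G.Adj b' c) :
    ∃ ψ : treeR ↪g G, IsClosedEmbedding S treeRLabel ψ ∧ ψ (.inr 0) = c ∧
      ∀ v, treeRLabel v ≠ A → ψ v = b ∨ ψ v = b' ∨ ψ v = c := by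
  obtain ⟨x, -, -, hx, -, hbx, -⟩ := h.pair_of_B b hb
  obtain ⟨φ, hφ, -, hφ1⟩ := h.exists_path_embedding hG hb hx hbx
  obtain ⟨ψ, hψ, hψ0, hψ1⟩ := h.exists_star3_embedding hG hb' hc hbc'
  have hp : ∀ v, pathLabel v ≠ A → v = 1 := by decide
  have hs : ∀ v, star3Label v ≠ A → v = 0 ∨ v = 1 := by decide
  have hout : ∀ v, star3Label v ≠ A → ψ v ∉ Set.range φ := by
    rintro v hv ⟨w, hw⟩
    have hl := hφ.label w
    rw [hw, hψ.label] at hl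
    have hw1 := hp w (by rwa [← hl])
    subst hw1
    rw [hφ1] at hw
    rcases hs v hv with rfl | rfl
    · rw [hψ0] at hw
      rw [hw, hc] at hb
      cases hb
    · exact hne (hw.trans hψ1)
  obtain ⟨Φ, hΦ, hΦe⟩ := hφ.attach hG hψ isTree_pathGraph_three.connected isTree_star3.connected
    exists_B_adj_star3 hout (u := 1) (x := 0) (by rwa [hφ1, hψ0])
  unfold treeR
  refine ⟨Φ, hΦ, by simp [hΦe, hψ0], ?_⟩
  rintro (v | v) hv
  · obtain rfl := hp v hv
    simp [hΦe, hφ1]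
  · rcases hs v hv with rfl | rfl <;> simp [hΦe, hψ0, hψ1]

end Growth

section Family

variable {V : Type*} {G : SimpleGraph V} {S : V → Status}

/-- A closed copy in `G` of a labeled tree of the family, if it does not cover `G`, can be
extended by one of the operations at an edge that leaves it. -/
theorem IsStatusLabeling.exists_larger (h : IsStatusLabeling G S) (hG : G.IsTree)
    {W : Type} {T : SimpleGraph W} {S' : W → Status} (hT : LabeledFamily W T S') {φ : T ↪g G}
    (hφ : IsClosedEmbedding S S' φ) (hsurj : ¬ Function.Surjective φ) :
    ∃ (W' : Type) (T' : SimpleGraph W') (S'' : W' → Status) (_ : LabeledFamily W' T' S'')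
      (φ' : T' ↪g G), IsClosedEmbedding S S'' φ' ∧ Nat.card W < Nat.card W' := by
  have hconn := hT.isTree.connected
  have hfin := hT.finite
  have hac := hG.isAcyclic
  obtain ⟨u, x, hux, hx⟩ : ∃ u x, G.Adj (φ u) x ∧ x ∉ Set.range φ := by
    have : Nonempty W := hconn.nonempty
    obtain ⟨y, hy⟩ := not_forall.1 hsurj
    obtain ⟨w⟩ := this
    obtain ⟨p⟩ := hG.connected.preconnected (φ w) y
    obtain ⟨d, -, ⟨u, hu⟩, hd⟩ := p.exists_boundary_dart (Set.range φ) ⟨w, rfl⟩ hy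
    exact ⟨u, d.snd, hu ▸ d.adj, hd⟩
  have hlab := hφ.label u
  have hone : ∀ w, G.Adj (φ w) x → w = u := fun w hw =>
    eq_of_adj_of_notMem_range hac φ hconn hx hux hw
  have hp : ∀ v, pathLabel v ≠ A → v = 1 := by decide
  rcases hSx : S x with _ | _ | _
  · -- `x` is the end of a path around its neighbour of status `B`, which `op1` adds
    obtain ⟨b, hb, hxb, huni⟩ := h.unique_of_A x hSx
    have hbr : b ∉ Set.range φ := by
      rintro ⟨w, rfl⟩
      exact hx (hφ.closed w x hxb.symm (.inr ⟨by rw [← hφ.label, hb], hSx⟩))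
    have hu : S' u = A ∨ S' u = C := by
      rcases hSu : S' u with _ | _ | _
      · exact .inl rfl
      · exact absurd (hφ.closed u x hux (.inr ⟨hSu, hSx⟩)) hx
      · exact .inr rfl
    obtain ⟨ψ, hψ, hψ0, hψ1⟩ := h.exists_path_embedding hac hb hSx hxb.symm
    obtain ⟨Φ, hΦ, -⟩ := hφ.attach hac hψ hconn isTree_pathGraph_three.connected
      exists_B_adj_path (fun v hv => by rwa [hp v hv, hψ1]) (u := u) (x := 0) (by rwa [hψ0])
    exact ⟨_, _, _, hT.op1 u hu, Φ, hΦ, by rw [Nat.card_sum, Nat.card_fin]; omega⟩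
  · -- `x` is the middle of a path, which `op3` adds
    have hu : S' u = C := by
      rcases hSu : S' u with _ | _ | _
      · exact absurd (hφ.closed u x hux (.inl ⟨hSu, hSx⟩)) hx
      · exact absurd hSx (h.not_adj_of_B _ _ (hlab.trans hSu) hux)
      · rfl
    obtain ⟨y, -, -, hy, -, hxy, -⟩ := h.pair_of_B x hSx
    obtain ⟨ψ, hψ, -, hψ1⟩ := h.exists_path_embedding hac hSx hy hxy
    obtain ⟨Φ, hΦ, -⟩ := hφ.attach hac hψ hconn isTree_pathGraph_three.connected
      exists_B_adj_path (fun v hv => by rwa [hp v hv, hψ1]) (u := u) (x := 1) (by rwa [hψ1])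
    exact ⟨_, _, _, hT.op3 u hu, Φ, hΦ, by rw [Nat.card_sum, Nat.card_fin]; omega⟩
  · -- `op2` adds a star if `u` is one of the neighbours of status `B` of `x`; otherwise two such
    -- neighbours are missing, and `op4` adds a copy of `R`
    obtain ⟨p, q, hpq, hpB, hqB, hxp, hxq⟩ := h.pair_of_C x hSx
    by_cases hu : S' u = B
    · obtain ⟨b, hb, hxb, hbr⟩ : ∃ b, S b = B ∧ G.Adj x b ∧ b ∉ Set.range φ := by
        by_cases hpr : p ∈ Set.range φ
        · refine ⟨q, hqB, hxq, ?_⟩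
          rintro ⟨w, rfl⟩
          obtain ⟨w', rfl⟩ := hpr
          rw [hone w hxq.symm, hone w' hxp.symm] at hpq
          exact hpq rfl
        · exact ⟨p, hpB, hxp, hpr⟩
      obtain ⟨ψ, hψ, hψ0, hψ1⟩ := h.exists_star3_embedding hac hb hSx hxb.symm
      have hs : ∀ v, star3Label v ≠ A → v = 0 ∨ v = 1 := by decide
      obtain ⟨Φ, hΦ, -⟩ := hφ.attach hac hψ hconn isTree_star3.connected exists_B_adj_star3
        (fun v hv => by rcases hs v hv with rfl | rfl; rwa [hψ0]; rwa [hψ1])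
        (u := u) (x := 0) (by rwa [hψ0])
      exact ⟨_, _, _, hT.op2 u hu, Φ, hΦ, by rw [Nat.card_sum, Nat.card_fin]; omega⟩
    · have hu' : S' u = A ∨ S' u = C := by
        rcases hSu : S' u with _ | _ | _ <;> simp_all
      have hout : ∀ b, S b = B → G.Adj x b → b ∉ Set.range φ := by
        rintro b hb hxb ⟨w, rfl⟩
        rw [hone w hxb.symm, hlab] at hb
        exact hu hb
      obtain ⟨ψ, hψ, hψ0, hψn⟩ :=
        h.exists_treeR_embedding hac hpq hpB hqB hSx hxp.symm hxq.symm
      obtain ⟨Φ, hΦ, -⟩ := hφ.attach hac hψ hconn isTree_treeR.connected exists_B_adj_treeR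
        (fun v hv => by
          rcases hψn v hv with hv | hv | hv <;> rw [hv]
          · exact hout p hpB hxp
          · exact hout q hqB hxq
          · exact hx)
        (u := u) (x := .inr 0) (by rwa [hψ0])
      exact ⟨_, _, _, hT.op4 u hu', Φ, hΦ, by
        rw [Nat.card_sum, Nat.card_sum, Nat.card_fin, Nat.card_fin]; omega⟩

theorem IsStatusLabeling.inFamilyT [Finite V] (h : IsStatusLabeling G S) (hG : G.IsTree) :
    InFamilyT G := by
  have key : ∀ k : ℕ, ∀ (W : Type) (T : SimpleGraph W) (S' : W → Status)
      (_ : LabeledFamily W T S') (φ : T ↪g G), IsClosedEmbedding S S' φ →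
      Nat.card V ≤ Nat.card W + k → InFamilyT G := by
    intro k
    induction k with
    | zero =>
      intro W T S' hT φ hφ hk
      have := hT.finite
      refine ⟨W, T, S', hT, ⟨(RelIso.ofSurjective φ ?_).symm⟩⟩
      exact ((Nat.bijective_iff_injective_and_card φ).2 ⟨φ.injective,
        le_antisymm (Nat.card_le_card_of_injective φ φ.injective) hk⟩).2
    | succ k ih =>
      intro W T S' hT φ hφ hk
      by_cases hsurj : Function.Surjective φ
      · exact ⟨W, T, S', hT, ⟨(RelIso.ofSurjective φ hsurj).symm⟩⟩
      · obtain ⟨W', T', S'', hT', φ', hφ', hlt⟩ := h.exists_larger hG hT hφ hsurj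
        exact ih W' T' S'' hT' φ' hφ' (by omega)
  obtain ⟨b, hb⟩ : ∃ b, S b = B := by
    obtain ⟨v⟩ := hG.connected.nonempty
    rcases hS : S v with _ | _ | _
    · obtain ⟨b, hb, -⟩ := h.unique_of_A v hS
      exact ⟨b, hb⟩
    · exact ⟨v, hS⟩
    · obtain ⟨b, -, -, hb, -⟩ := h.pair_of_C v hS
      exact ⟨b, hb⟩
  obtain ⟨x, -, -, hx, -, hbx, -⟩ := h.pair_of_B b hb
  obtain ⟨ψ, hψ, -⟩ := h.exists_path_embedding hG.isAcyclic hb hx hbx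
  exact key (Nat.card V) _ _ _ .base ψ hψ (Nat.le_add_left _ _)

/-- The trees in the class are the trees of the family. -/
theorem inFamilyT_iff [Fintype V] [DecidableEq V] : InFamilyT G ↔ G.IsTree ∧ InRUVR G := by
  constructor
  · rintro ⟨W, T, S, hT, ⟨e⟩⟩
    have htree : G.IsTree := e.isTree_iff.2 hT.isTree
    exact ⟨htree, (hT.isStatusLabeling.of_iso e).inRUVR_of_isAcyclic htree.isAcyclic⟩
  · rintro ⟨htree, hR⟩
    obtain ⟨S, hS⟩ := hR.exists_isStatusLabeling htree.isAcyclic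
    exact hS.inFamilyT htree

end Family

/-! ### Sizes and isomorphisms -/

section Sizes

variable {V W : Type*} {G : SimpleGraph V} {H : SimpleGraph W}

theorem ncard_edgeSet_of_iso (e : G ≃g H) : G.edgeSet.ncard = H.edgeSet.ncard := by
  rw [← Nat.card_coe_set_eq, ← Nat.card_coe_set_eq]
  exact Nat.card_congr e.mapEdgeSet

theorem card_le_ncard_edgeSet [Finite V] (E : Finset (Sym2 V)) (hE : ∀ e ∈ E, e ∈ G.edgeSet) :
    #E ≤ G.edgeSet.ncard := by
  rw [← Set.ncard_coe_finset]
  exact Set.ncard_le_ncard hE (Set.toFinite _)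

theorem isTree_iff_ncard [Fintype V] :
    G.IsTree ↔ G.Connected ∧ G.edgeSet.ncard + 1 = Fintype.card V := by
  rw [SimpleGraph.isTree_iff_connected_and_card, Nat.card_coe_set_eq, Nat.card_eq_fintype_card]

theorem card_le_ncard_add_one [Fintype V] (hG : G.Connected) :
    Fintype.card V ≤ G.edgeSet.ncard + 1 := by
  rw [← Nat.card_eq_fintype_card, ← Nat.card_coe_set_eq]
  exact hG.card_vert_le_card_edgeSet_add_one

theorem ncard_edgeSet_le_of_injective [Finite V] (f : H →g G) (hf : Function.Injective f) :
    H.edgeSet.ncard ≤ G.edgeSet.ncard := by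
  rw [← Set.ncard_image_of_injective _ (Sym2.map.injective hf)]
  refine Set.ncard_le_ncard ?_ (Set.toFinite _)
  rintro _ ⟨e, he, rfl⟩
  exact f.map_mem_edgeSet he

/-- A spanning subgraph with at least as many edges is the whole graph. -/
theorem nonempty_iso_of_injective [Finite V] [Finite W] (f : H →g G)
    (hf : Function.Injective f) (hcard : Nat.card W = Nat.card V)
    (hle : G.edgeSet.ncard ≤ H.edgeSet.ncard) : Nonempty (G ≃g H) := by
  have hbij : Function.Bijective f := (Nat.bijective_iff_injective_and_card f).2 ⟨hf, hcard⟩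
  have hsub : Sym2.map f '' H.edgeSet ⊆ G.edgeSet := by
    rintro _ ⟨e, he, rfl⟩
    exact f.map_mem_edgeSet he
  have heq := Set.eq_of_subset_of_ncard_le hsub (by
    rwa [Set.ncard_image_of_injective _ (Sym2.map.injective hf)]) (Set.toFinite _)
  refine ⟨SimpleGraph.Iso.symm ⟨Equiv.ofBijective f hbij, fun {a b} => ?_⟩⟩
  refine ⟨fun h => ?_, fun h => f.map_adj h⟩
  have h' : s(f a, f b) ∈ G.edgeSet := h
  rw [← heq] at h'
  obtain ⟨e, he, hee⟩ := h'
  have : e = s(a, b) := Sym2.map.injective hf (hee.trans rfl)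
  rwa [this] at he

variable [Fintype V]

theorem InFamilyT.exists_card_eq (h : InFamilyT G) :
    ∃ a b, Fintype.card V = 3 + 3 * a + 4 * b := by
  obtain ⟨W, T, S, hT, ⟨e⟩⟩ := h
  rw [← Nat.card_eq_fintype_card, Nat.card_congr e.toEquiv]
  exact hT.card_eq

theorem InFamilyT.card_mem (h : InFamilyT G) :
    Fintype.card V = 3 ∨ Fintype.card V = 6 ∨ Fintype.card V = 7 ∨ 9 ≤ Fintype.card V := by
  obtain ⟨a, b, hab⟩ := h.exists_card_eq
  rcases a with _ | _ | a <;> rcases b with _ | _ | b <;> omega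

theorem exists_eq_add_of_mem {n : ℕ} (h : n = 3 ∨ n = 6 ∨ n = 7 ∨ 9 ≤ n) :
    ∃ a b, n = 3 + 3 * a + 4 * b := by
  -- the number of summands `4` is the residue of `n` modulo `3`
  exact ⟨(n - 3 - 4 * (n % 3)) / 3, n % 3, by omega⟩

theorem exists_inFamilyT {a b : ℕ} (h : Fintype.card V = 3 + 3 * a + 4 * b) :
    ∃ G : SimpleGraph V, InFamilyT G := by
  obtain ⟨W, T, S, hT, -, -, hc⟩ := exists_labeledFamily_card_eq a b
  have := hT.finite
  obtain ⟨e⟩ : Nonempty (W ≃ V) :=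
    Finite.card_eq.1 (by rw [hc, Nat.card_eq_fintype_card, h])
  exact ⟨T.map e.toEmbedding, W, T, S, hT, ⟨(SimpleGraph.Iso.map e T).symm⟩⟩

variable [DecidableEq V] [Fintype W] [DecidableEq W]

/-- A graph `H` of the class is, up to isomorphism, the only minimum graph of its order if every
other graph of the class of this order has more edges. -/
theorem isLeast_and_isMinimumSize_iff (hcard : Fintype.card W = Fintype.card V)
    (hH : H.Connected) (hHR : InRUVR H)
    (hmin : ∀ G : SimpleGraph V, G.Connected → InRUVR G → H.edgeSet.ncard ≤ G.edgeSet.ncard ∧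
      (G.edgeSet.ncard ≤ H.edgeSet.ncard → Nonempty (G ≃g H))) :
    IsLeast (connectedSizes V) H.edgeSet.ncard ∧
      ∀ G : SimpleGraph V, IsMinimumSize G ↔ Nonempty (G ≃g H) := by
  have e : H ≃g H.map (Fintype.equivOfCardEq hcard).toEmbedding := SimpleGraph.Iso.map _ _
  have hc := e.connected_iff.1 hH
  have hR := hHR.of_iso e.symm
  refine ⟨⟨⟨_, hc, hR, (ncard_edgeSet_of_iso e).symm⟩, ?_⟩, fun G => ⟨fun ⟨h1, h2, h3⟩ => ?_, ?_⟩⟩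
  · rintro _ ⟨G, h1, h2, rfl⟩
    exact (hmin G h1 h2).1
  · refine (hmin G h1 h2).2 ?_
    rw [ncard_edgeSet_of_iso e]
    exact h3 _ hc hR
  · rintro ⟨e'⟩
    refine ⟨e'.connected_iff.2 hH, hHR.of_iso e', fun G' h1 h2 => ?_⟩
    rw [ncard_edgeSet_of_iso e']
    exact (hmin G' h1 h2).1

end Sizes

/-! ### Roman domination number two -/

section Universal

variable {V : Type*} [Fintype V] [DecidableEq V] {G : SimpleGraph V}

theorem add_le_weight (f : V → Fin 3) {u v : V} (h : u ≠ v) :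
    (f u : ℕ) + (f v : ℕ) ≤ weight f := by
  rw [← sum_pair (f := fun x => (f x : ℕ)) h]
  exact sum_le_sum_of_subset (subset_univ _)

/-- A function that dominates all vertices other than `b` has the value `2` somewhere, or is
positive at all vertices other than `b`. -/
theorem exists_eq_two_or_card_le {f : V → Fin 3} {b : V}
    (hf : ∀ v, v ≠ b → f v = 0 → ∃ u, G.Adj v u ∧ f u = 2) :
    (∃ u, f u = 2) ∨ Fintype.card V ≤ weight f + 1 := by
  by_cases h : ∃ u, f u = 2
  · exact .inl h
  · right
    have hfin : ∀ x : Fin 3, x ≠ 0 → 1 ≤ (x : ℕ) := by decide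
    have h1 : ∀ v ∈ univ.erase b, 1 ≤ (f v : ℕ) := fun v hv => hfin _ fun h0 => by
      obtain ⟨u, -, hu⟩ := hf v (ne_of_mem_erase hv) h0
      exact h ⟨u, hu⟩
    have h2 := card_nsmul_le_sum _ _ _ h1
    have h3 : ∑ v ∈ univ.erase b, (f v : ℕ) ≤ weight f := sum_le_sum_of_subset (subset_univ _)
    rw [smul_eq_mul, mul_one, card_erase_of_mem (mem_univ _), card_univ] at h2
    omega

theorem inRUVR_of_universal (hcard : 4 ≤ Fintype.card V) {u v : V} (huv : u ≠ v)
    (hu : G.IsUniversal u) (hv : G.IsUniversal v) : InRUVR G := by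
  have hoff : ∀ b u, G.IsUniversal u → u ≠ b → IsRDFOff G b (twice {u}) := by
    intro b u hu hub
    refine ⟨by simpa [twice_eq_zero] using hub.symm, fun w _ hw => ⟨u, ?_, by simp [twice]⟩⟩
    rw [twice_eq_zero, mem_singleton] at hw
    exact (hu (Ne.symm hw)).symm
  have hrdf : IsRDF G (twice {u}) := by
    intro w hw
    rw [twice_eq_zero, mem_singleton] at hw
    exact ⟨u, (hu (Ne.symm hw)).symm, by simp [twice]⟩
  have hwt : ∀ x : V, weight (twice {x}) = 2 := fun x => by simp [weight_twice]
  have htwo : ∀ f, IsRDF G f → weight f ≤ 2 → ∃ x, f x = 2 := by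
    intro f hf hw
    exact (exists_eq_two_or_card_le (b := u) fun v _ => hf v).resolve_right (by omega)
  have hnum : romanNumber G = 2 := by
    refine le_antisymm (hwt u ▸ romanNumber_le hrdf) ?_
    obtain ⟨f, hf, hw⟩ := exists_isRDF_weight_eq G
    by_contra! hlt
    obtain ⟨x, hx⟩ := htwo f hf (by omega)
    obtain ⟨y, hy⟩ := Fintype.exists_ne_of_one_lt_card (by omega : 1 < Fintype.card V) x
    have := add_le_weight f hy
    rw [hx] at this
    simp only [Fin.val_two] at this
    omega
  refine inRUVR_of_forall (fun f hf hw w hw1 => ?_) fun w => ?_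
  · obtain ⟨x, hx⟩ := htwo f hf (by omega)
    have hxw : x ≠ w := by
      rintro rfl
      rw [hx] at hw1
      simp at hw1
    have := add_le_weight f hxw
    rw [hx, hw1] at this
    simp only [Fin.val_two, Fin.val_one] at this
    omega
  · by_cases hwu : u = w
    · exact ⟨_, hoff w v hv (hwu ▸ huv.symm), by rw [hwt, hnum]⟩
    · exact ⟨_, hoff w u hu hwu, by rw [hwt, hnum]⟩

/-- The vertex `v` with value `2` is universal; after its deletion another universal vertex is
needed. -/
theorem InRUVR.exists_universal (hG : InRUVR G) (hcard : 4 ≤ Fintype.card V) {v : V}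
    (hv : IsRDF G (twice {v})) (hnum : romanNumber G = 2) :
    ∃ u, u ≠ v ∧ G.IsUniversal u ∧ G.IsUniversal v := by
  have huniv : G.IsUniversal v := by
    intro w hw
    obtain ⟨x, hx, hx2⟩ := hv w (by simpa [twice_eq_zero] using hw.symm)
    rw [twice_eq_two, mem_singleton] at hx2
    exact hx2 ▸ hx.symm
  obtain ⟨g, ⟨hgv, hg⟩, hw⟩ := hG.exists_isRDFOff v
  obtain ⟨u, hu⟩ := (exists_eq_two_or_card_le hg).resolve_right (by omega)
  have huv : u ≠ v := by
    rintro rfl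
    rw [hu] at hgv
    simp at hgv
  refine ⟨u, huv, fun w hw' => ?_, huniv⟩
  by_cases hwv : w = v
  · exact hwv ▸ (huniv huv.symm).symm
  · have h0 : ∀ x, u ≠ x → g x = 0 := by
      intro x hx
      have := add_le_weight g hx
      rw [hu] at this
      simp only [Fin.val_two] at this
      exact Fin.ext (by simp only [Fin.val_zero]; omega)
    obtain ⟨x, hx, hx2⟩ := hg w hwv (h0 w hw')
    by_cases hxu : u = x
    · exact hxu ▸ hx.symm
    · rw [h0 x hxu] at hx2
      simp at hx2

/-- A graph with two universal vertices contains the join of `K₂` with an empty graph as a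
spanning subgraph. -/
theorem exists_join_hom {m : ℕ} (hcard : Fintype.card V = m + 2) {u v : V} (huv : u ≠ v)
    (hu : G.IsUniversal u) (hv : G.IsUniversal v) :
    ∃ f : join (⊤ : SimpleGraph (Fin 2)) (⊤ : SimpleGraph (Fin m))ᶜ →g G,
      Function.Injective f := by
  have hc : #((univ.erase u).erase v) = m := by
    rw [card_erase_of_mem (by simp [huv.symm]), card_erase_of_mem (mem_univ _), card_univ]
    omega
  let e := ((univ.erase u).erase v).equivFinOfCardEq hc
  have he : ∀ i, (e.symm i : V) ≠ u ∧ (e.symm i : V) ≠ v := fun i => by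
    have := (e.symm i).2
    simp only [mem_erase] at this
    exact ⟨this.2.1, this.1⟩
  have hinj : Function.Injective (Sum.elim ![u, v] fun i => (e.symm i : V)) := by
    refine Function.Injective.sumElim ?_ (Subtype.val_injective.comp e.symm.injective) ?_
    · intro i j
      fin_cases i <;> fin_cases j <;> simp [huv, huv.symm]
    · intro i j
      fin_cases i
      · exact (he j).1.symm
      · exact (he j).2.symm
  have hall : ∀ (i : Fin 2) w, ![u, v] i ≠ w → G.Adj (![u, v] i) w := by
    intro i w
    fin_cases i
    · exact fun h => hu h
    · exact fun h => hv h
  refine ⟨⟨_, ?_⟩, hinj⟩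
  rintro (i | i) (j | j) hij
  · exact hall i _ fun h => hij.ne (hinj h)
  · exact hall i _ fun h => hij.ne (hinj h)
  · exact (hall j _ fun h => hij.ne' (hinj h)).symm
  · simp [join] at hij

instance {m : ℕ} : DecidableRel (join (⊤ : SimpleGraph (Fin 2)) (⊤ : SimpleGraph (Fin m))ᶜ).Adj :=
  fun a b => decidable_of_iff ((a.isLeft ∨ b.isLeft) ∧ a ≠ b) (by
    rcases a with a | a <;> rcases b with b | b <;> simp [join])

theorem isUniversal_join {m : ℕ} (i : Fin 2) :
    (join (⊤ : SimpleGraph (Fin 2)) (⊤ : SimpleGraph (Fin m))ᶜ).IsUniversal (.inl i) := by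
  rintro (j | j) h
  · simpa [join] using h
  · simp [join]

theorem isLeast_join {n : ℕ} (hn : n = 4 ∨ n = 5) (hcard : Fintype.card V = n) :
    IsLeast (connectedSizes V) (2 * n - 3) ∧
      ∀ G : SimpleGraph V, IsMinimumSize G ↔
        Nonempty (G ≃g join (⊤ : SimpleGraph (Fin 2)) (⊤ : SimpleGraph (Fin (n - 2)))ᶜ) := by
  have hsize : (join (⊤ : SimpleGraph (Fin 2)) (⊤ : SimpleGraph (Fin (n - 2)))ᶜ).edgeSet.ncard
      = 2 * n - 3 := by
    rw [Set.ncard_eq_toFinset_card']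
    rcases hn with rfl | rfl <;> decide
  have hcardj : Fintype.card (Fin 2 ⊕ Fin (n - 2)) = n := by
    rw [Fintype.card_sum, Fintype.card_fin, Fintype.card_fin]
    omega
  rw [← hsize]
  refine isLeast_and_isMinimumSize_iff (hcardj.trans hcard.symm)
    (.of_isUniversal (isUniversal_join 0))
    (inRUVR_of_universal (by omega) (u := .inl 0) (v := .inl 1) (by simp) (isUniversal_join 0)
      (isUniversal_join 1)) fun G hc hR => ?_
  obtain ⟨B', hrdf, hnum, h3⟩ := hR.exists_twice
  have hB := three_mul_card_le h3
  have hB0 : #B' ≠ 0 := by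
    intro h0
    rw [card_eq_zero] at h0
    obtain ⟨v⟩ := hc.nonempty
    obtain ⟨w, -, hw⟩ := hrdf v (by simp [twice_eq_zero, h0])
    simp [twice_eq_two, h0] at hw
  obtain ⟨v, rfl⟩ := card_eq_one.1 (by omega : #B' = 1)
  obtain ⟨u, huv, hu, hv⟩ := hR.exists_universal (by omega) hrdf (by simpa using hnum)
  obtain ⟨f, hf⟩ := exists_join_hom (m := n - 2) (by omega) huv hu hv
  refine ⟨ncard_edgeSet_le_of_injective f hf, nonempty_iso_of_injective f hf ?_⟩
  rw [Nat.card_eq_fintype_card, Nat.card_eq_fintype_card, hcardj, hcard]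

end Universal

/-! ### Order eight -/

section Eight

theorem ncard_edgeSet_unicyclic8 : unicyclic8.edgeSet.ncard = 8 := by
  have h : unicyclic8.edgeSet = ((({s(0, 1), s(1, 2), s(2, 3), s(3, 0), s(0, 4), s(0, 5), s(2, 6),
      s(2, 7)} : Finset (Sym2 (Fin 8)))) : Set (Sym2 (Fin 8))) := by
    rw [unicyclic8, SimpleGraph.edgeSet_fromEdgeSet, sdiff_eq_left.2]
    · simp
    · rw [Set.disjoint_left]
      intro e he
      simp only [Set.mem_insert_iff, Set.mem_singleton_iff] at he
      rcases he with rfl | rfl | rfl | rfl | rfl | rfl | rfl | rfl <;> simp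
  rw [h, Set.ncard_coe_finset]
  decide

instance : DecidableRel unicyclic8.Adj := fun a b =>
  decidable_of_iff (s(a, b) ∈ ({s(0, 1), s(1, 2), s(2, 3), s(3, 0), s(0, 4), s(0, 5), s(2, 6),
      s(2, 7)} : Finset (Sym2 (Fin 8))) ∧ a ≠ b) (by simp [unicyclic8])

theorem connected_unicyclic8 : unicyclic8.Connected := by
  have h : ∀ a b, unicyclic8.Adj a b → unicyclic8.Reachable 0 a → unicyclic8.Reachable 0 b :=
    fun a b hab ha => ha.trans hab.reachable
  have h0 : unicyclic8.Reachable 0 0 := .rfl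
  have h1 := h 0 1 (by decide) h0
  have h2 := h 1 2 (by decide) h1
  have hr : ∀ v, unicyclic8.Reachable 0 v := by
    intro v
    fin_cases v
    · exact h0
    · exact h1
    · exact h2
    · exact h 0 3 (by decide) h0
    · exact h 0 4 (by decide) h0
    · exact h 0 5 (by decide) h0
    · exact h 2 6 (by decide) h2
    · exact h 2 7 (by decide) h2
  exact ⟨fun a b => (hr a).symm.trans (hr b)⟩

theorem isStatusLabeling_unicyclic8 : IsStatusLabeling unicyclic8 ![B, C, B, C, A, A, A, A] := by
  constructor <;> decide

theorem inRUVR_unicyclic8 : InRUVR unicyclic8 := by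
  refine isStatusLabeling_unicyclic8.inRUVR (B' := {0, 2}) (by decide) fun g hg => ?_
  have hleaf : ∀ l c : Fin 8, (∀ u, unicyclic8.Adj l u → u = c) → g c ≠ 2 → 1 ≤ (g l : ℕ) := by
    intro l c hl hc
    by_contra! h0
    obtain ⟨u, hu, hu2⟩ := hg l (Fin.ext (by simp only [Fin.val_zero]; omega))
    exact hc (hl u hu ▸ hu2)
  have h4 := hleaf 4 0 (by decide)
  have h5 := hleaf 5 0 (by decide)
  have h6 := hleaf 6 2 (by decide)
  have h7 := hleaf 7 2 (by decide)
  have hval : ∀ v, (g v = 2 ↔ (g v : ℕ) = 2) ∧ (g v = 0 ↔ (g v : ℕ) = 0) := fun v =>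
    ⟨Fin.ext_iff, Fin.ext_iff⟩
  have hdom : ∀ v, (g v : ℕ) = 0 → ∃ u, unicyclic8.Adj v u ∧ (g u : ℕ) = 2 := by
    intro v hv
    obtain ⟨u, hu, hu2⟩ := hg v ((hval v).2.2 hv)
    exact ⟨u, hu, (hval u).1.1 hu2⟩
  have n0 : ∀ u, unicyclic8.Adj 0 u → u = 1 ∨ u = 3 ∨ u = 4 ∨ u = 5 := by decide
  have n1 : ∀ u, unicyclic8.Adj 1 u → u = 0 ∨ u = 2 := by decide
  have n2 : ∀ u, unicyclic8.Adj 2 u → u = 1 ∨ u = 3 ∨ u = 6 ∨ u = 7 := by decide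
  have d0 : (g 0 : ℕ) = 0 → (g 1 : ℕ) = 2 ∨ (g 3 : ℕ) = 2 ∨ (g 4 : ℕ) = 2 ∨ (g 5 : ℕ) = 2 := by
    intro h
    obtain ⟨u, hu, hu2⟩ := hdom 0 h
    rcases n0 u hu with rfl | rfl | rfl | rfl <;> simp [hu2]
  have d1 : (g 1 : ℕ) = 0 → (g 0 : ℕ) = 2 ∨ (g 2 : ℕ) = 2 := by
    intro h
    obtain ⟨u, hu, hu2⟩ := hdom 1 h
    rcases n1 u hu with rfl | rfl <;> simp [hu2]
  have d2 : (g 2 : ℕ) = 0 → (g 1 : ℕ) = 2 ∨ (g 3 : ℕ) = 2 ∨ (g 6 : ℕ) = 2 ∨ (g 7 : ℕ) = 2 := by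
    intro h
    obtain ⟨u, hu, hu2⟩ := hdom 2 h
    rcases n2 u hu with rfl | rfl | rfl | rfl <;> simp [hu2]
  rw [Ne, (hval 0).1] at h4 h5
  rw [Ne, (hval 2).1] at h6 h7
  have hw : weight g = g 0 + g 1 + g 2 + g 3 + g 4 + g 5 + g 6 + g 7 := by
    simp [weight, Fin.sum_univ_eight]
  by_cases hlt : 4 < weight g
  · right
    simpa using hlt
  · left
    rw [hw] at hlt
    have g0 : (g 0 : ℕ) = 2 := by omega
    have g2 : (g 2 : ℕ) = 2 := by omega
    funext v
    apply Fin.ext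
    fin_cases v <;> simp [twice] <;> omega

variable {V : Type*} [Fintype V] [DecidableEq V] {G : SimpleGraph V}

/-- In a connected graph of order eight with at most eight edges and with a Roman dominating function
`twice {b, b'}`, a function of weight four that dominates `G - b` forces `b` to have at most two
private neighbours. Six edges join each vertex other than `b`, `b'` to one of these two; each
further vertex that is dominated by a vertex of value `2` other than `b'` needs another edge. -/
theorem card_private_lt_three (hc : G.Connected) (hcard : Fintype.card V = 8)
    (hsize : G.edgeSet.ncard ≤ 8) {b b' : V} (hbb : b ≠ b')
    (hdom : ∀ v, v ≠ b → v ≠ b' → G.Adj v b ∨ G.Adj v b') {P : Finset V}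
    (hP : ∀ v, v ∈ P ↔ v ≠ b' ∧ G.Adj v b ∧ ¬ G.Adj v b') {g : V → Fin 3}
    (hg : IsRDFOff G b g) (hw : weight g = 4) : #P < 3 := by
  classical
  by_contra! hP3
  obtain ⟨hgb, hg⟩ := hg
  have hfin : ∀ x : Fin 3, x ≠ 0 → 1 ≤ (x : ℕ) := by decide
  have hPb : ∀ v ∈ P, v ≠ b ∧ v ≠ b' := fun v hv => ⟨((hP v).1 hv).2.1.ne, ((hP v).1 hv).1⟩
  set R : Finset V := (univ.erase b).erase b' with hR
  have hRmem : ∀ v, v ∈ R ↔ v ≠ b ∧ v ≠ b' := by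
    intro v
    simp [hR, and_comm]
  have hRcard : #R = 6 := by
    rw [hR, card_erase_of_mem (by simp [hbb.symm]), card_erase_of_mem (mem_univ _), card_univ,
      hcard]
  have hPR : P ⊆ R := fun v hv => (hRmem v).2 (hPb v hv)
  have hwR : (g b' : ℕ) + ∑ v ∈ R, (g v : ℕ) = 4 := by
    rw [hR, add_sum_erase _ (fun v => (g v : ℕ)) (by simp [hbb.symm] : b' ∈ univ.erase b)]
    have := add_sum_erase _ (fun v => (g v : ℕ)) (mem_univ b)
    rw [hgb] at this
    simp only [Fin.val_zero, zero_add] at this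
    rw [this, ← hw, weight]
  have hnb : ∀ u, g u = 2 → u ≠ b := by
    rintro u hu rfl
    rw [hgb] at hu
    simp at hu
  -- the vertex of `b`, `b'` that dominates `v`
  let c : V → V := fun v => if v ∈ P then b else b'
  have hc' : ∀ v, c v = b ∨ c v = b' := fun v => by
    simp only [c]; split <;> simp
  have hadj : ∀ v ∈ R, G.Adj v (c v) := by
    intro v hv
    rw [hRmem] at hv
    have := hdom v hv.1 hv.2
    have := hP v
    simp only [c]
    split <;> tauto
  let E1 : Finset (Sym2 V) := R.image fun v => s(v, c v)
  have hE1 : #E1 = 6 := by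
    rw [← hRcard]
    refine card_image_of_injOn fun v hv w hw' hvw => ?_
    rcases Sym2.eq_iff.1 hvw with h | h
    · exact h.1
    · have h1 := (hRmem v).1 hv
      rw [h.1] at h1
      rcases hc' w with h2 | h2 <;> rw [h2] at h1 <;> tauto
  have hedge : ∀ Z ⊆ R, ∀ u : V → V, (∀ v ∈ Z, g v = 0 ∧ G.Adj v (u v) ∧ g (u v) = 2 ∧
      u v ≠ b') → ∀ E3 : Finset (Sym2 V), (∀ e ∈ E3, e ∈ G.edgeSet ∧ e ∉ E1 ∧
        ∀ v ∈ Z, e ≠ s(v, u v)) → #Z + #E3 ≤ 2 := by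
    intro Z hZ u hu E3 hE3
    let E2 : Finset (Sym2 V) := Z.image fun v => s(v, u v)
    have hE2 : #E2 = #Z := by
      refine card_image_of_injOn fun v hv w hw' hvw => ?_
      rcases Sym2.eq_iff.1 hvw with h | h
      · exact h.1
      · have h1 := (hu v hv).1
        rw [h.1, (hu w hw').2.2.1] at h1
        simp at h1
    have hd12 : Disjoint E1 E2 := by
      refine disjoint_left.2 fun e he he' => ?_
      obtain ⟨v, hv, rfl⟩ := mem_image.1 he
      obtain ⟨w, hw', hwe⟩ := mem_image.1 he'
      have hcm : c v ∈ s(w, u w) := hwe ▸ Sym2.mem_mk_right _ _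
      have h1 := (hRmem w).1 (hZ hw')
      have h2 := hu w hw'
      have h3 := hnb _ h2.2.2.1
      rcases Sym2.mem_iff.1 hcm with h | h <;> rcases hc' v with h4 | h4 <;> rw [h4] at h <;>
        simp_all
    have hd3 : Disjoint (E1 ∪ E2) E3 := by
      refine disjoint_right.2 fun e he he' => ?_
      rcases mem_union.1 he' with h | h
      · exact (hE3 e he).2.1 h
      · obtain ⟨w, hw', rfl⟩ := mem_image.1 h
        exact (hE3 _ he).2.2 w hw' rfl
    have hle := card_le_ncard_edgeSet (G := G) (E1 ∪ E2 ∪ E3) (by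
      intro e he
      rcases mem_union.1 he with h | h
      · rcases mem_union.1 h with h | h
        · obtain ⟨v, hv, rfl⟩ := mem_image.1 h
          exact hadj v hv
        · obtain ⟨v, hv, rfl⟩ := mem_image.1 h
          exact (hu v hv).2.1
      · exact (hE3 e h).1)
    rw [card_union_of_disjoint hd3, card_union_of_disjoint hd12, hE1, hE2] at hle
    omega
  choose! u hu hu2 using hg
  by_cases hb2 : g b' = 2
  · have hRsum : ∑ v ∈ R, (g v : ℕ) = 2 := by
      rw [hb2] at hwR
      simp only [Fin.val_two] at hwR
      omega
    have hub' : ∀ v ∈ P, g v = 0 → u v ≠ b' := fun v hv h0 h =>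
      ((hP v).1 hv).2.2 (h ▸ hu v (hPb v hv).1 h0)
    -- a vertex of value `2` other than `b'` is the only vertex of `R` of positive value
    have honly : ∀ x ∈ R, g x = 2 → ∀ y ∈ R, y ≠ x → g y = 0 := by
      intro x hx hx2 y hy hyx
      have h1 := sum_le_sum_of_subset (f := fun v => (g v : ℕ)) (s := {x, y}) (t := R) (by
        intro z hz
        rcases mem_insert.1 hz with rfl | hz
        · exact hx
        · exact (mem_singleton.1 hz) ▸ hy)
      rw [sum_pair hyx.symm, hx2, hRsum] at h1
      simp only [Fin.val_two] at h1
      exact Fin.ext (by simp only [Fin.val_zero]; omega)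
    obtain ⟨v, hvP, hv0⟩ : ∃ v ∈ P, g v = 0 := by
      by_contra! h
      have h1 := card_nsmul_le_sum P (fun v => (g v : ℕ)) 1 fun v hv => hfin _ (h v hv)
      have h2 := sum_le_sum_of_subset (f := fun v => (g v : ℕ)) hPR
      rw [smul_eq_mul, mul_one] at h1
      omega
    have hv := hPb v hvP
    have huR : u v ∈ R := (hRmem _).2 ⟨hnb _ (hu2 v hv.1 hv0), hub' v hvP hv0⟩
    have hzero : ∀ w ∈ R, w ≠ u v → g w = 0 := honly _ huR (hu2 v hv.1 hv0)
    by_cases huP : u v ∈ P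
    · -- an edge that leaves the closed private neighbourhood of `b` is needed as well
      obtain ⟨p⟩ := hc.preconnected b b'
      obtain ⟨d, -, hd1, hd2⟩ := p.exists_boundary_dart (insert b P : Finset V) (by simp) (by
        simp only [coe_insert, Set.mem_insert_iff, mem_coe, not_or]
        exact ⟨hbb.symm, fun h => (hPb _ h).2 rfl⟩)
      rw [mem_coe] at hd1 hd2
      have hZ : ∀ w ∈ P.erase (u v), g w = 0 := fun w hw' =>
        hzero w (hPR (mem_of_mem_erase hw')) (ne_of_mem_erase hw')
      have hZu : ∀ w ∈ P.erase (u v), u w ∈ P := by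
        intro w hw'
        have hwP := mem_of_mem_erase hw'
        have h2 := hu2 w (hPb w hwP).1 (hZ w hw')
        by_cases heq : u w = u v
        · exact heq ▸ huP
        · have := hzero (u w) ((hRmem _).2 ⟨hnb _ h2, hub' w hwP (hZ w hw')⟩) heq
          rw [h2] at this
          simp at this
      have := hedge (P.erase (u v)) ((erase_subset _ _).trans hPR) u (fun w hw' => by
          have hwP := mem_of_mem_erase hw'
          exact ⟨hZ w hw', hu w (hPb w hwP).1 (hZ w hw'), hu2 w (hPb w hwP).1 (hZ w hw'),
            hub' w hwP (hZ w hw')⟩) {s(d.fst, d.snd)} (by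
        intro e he
        rw [mem_singleton] at he
        subst he
        refine ⟨d.adj, fun hmem => ?_, fun w hw' heq => ?_⟩
        · obtain ⟨w, hw', hwe⟩ := mem_image.1 hmem
          by_cases hwP : w ∈ P
          · have hcw : c w = b := by simp [c, hwP]
            have h2 : d.snd ∈ s(w, c w) := hwe ▸ Sym2.mem_mk_right _ _
            rw [hcw] at h2
            rcases Sym2.mem_iff.1 h2 with h | h
            · exact hd2 (h ▸ mem_insert_of_mem hwP)
            · exact hd2 (h ▸ mem_insert_self _ _)
          · have hcw : c w = b' := by simp [c, hwP]
            have h1 : d.fst ∈ s(w, c w) := hwe ▸ Sym2.mem_mk_left _ _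
            rw [hcw] at h1
            rcases Sym2.mem_iff.1 h1 with h | h <;> rw [h, mem_insert] at hd1 <;>
              rcases hd1 with h' | h'
            · exact ((hRmem w).1 hw').1 h'
            · exact hwP h'
            · exact hbb h'.symm
            · exact (hPb _ h').2 rfl
        · have h2 : d.snd ∈ s(w, u w) := heq ▸ Sym2.mem_mk_right _ _
          rcases Sym2.mem_iff.1 h2 with h | h
          · exact hd2 (h ▸ mem_insert_of_mem (mem_of_mem_erase hw'))
          · exact hd2 (h ▸ mem_insert_of_mem (hZu w hw')))
      rw [card_singleton] at this
      have := card_erase_add_one huP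
      omega
    · have hZ : ∀ w ∈ P, g w = 0 := fun w hw' => hzero w (hPR hw') fun h => huP (h ▸ hw')
      have := hedge P hPR u (fun w hw' => ⟨hZ w hw', hu w (hPb w hw').1 (hZ w hw'),
        hu2 w (hPb w hw').1 (hZ w hw'), hub' w hw' (hZ w hw')⟩) ∅ (by simp)
      omega
  · have hZ := hedge {v ∈ R | g v = 0} (filter_subset _ _) u (fun v hv => by
      rw [mem_filter] at hv
      have hvb := ((hRmem v).1 hv.1).1
      exact ⟨hv.2, hu v hvb hv.2, hu2 v hvb hv.2, fun h => hb2 (h ▸ hu2 v hvb hv.2)⟩) ∅ (by simp)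
    have hsplit := card_filter_add_card_filter_not (s := R) (fun v => g v = 0)
    have hle : ∀ v ∈ R, (if ¬ g v = 0 then 1 else 0) ≤ (g v : ℕ) := fun v _ => by
      split
      · exact hfin _ ‹_›
      · exact Nat.zero_le _
    have hpos : #{v ∈ R | ¬ g v = 0} ≤ ∑ v ∈ R, (g v : ℕ) := by
      rw [card_filter]
      exact sum_le_sum hle
    rw [card_empty] at hZ
    have hb0 : g b' = 0 := Fin.ext (by simp only [Fin.val_zero]; omega)
    have h2 := hu2 b' hbb.symm hb0
    have huR : u b' ∈ R := (hRmem _).2 ⟨hnb _ h2, (hu b' hbb.symm hb0).ne'⟩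
    have : #{v ∈ R | ¬ g v = 0} < ∑ v ∈ R, (g v : ℕ) := by
      rw [card_filter]
      exact sum_lt_sum hle ⟨_, huR, by rw [h2]; decide⟩
    omega

/-- Two vertices with two private neighbours each and two common neighbours span a copy of
`unicyclic8`. -/
theorem exists_unicyclic8_hom (hcard : Fintype.card V = 8) {S : V → Status}
    (hS : IsStatusLabeling G S) {b b' : V} (hbb : b ≠ b') (hB : ∀ v, S v = B ↔ v = b ∨ v = b') :
    ∃ f : unicyclic8 →g G, Function.Injective f := by
  obtain ⟨x, y, hxy, hx, hy, hbx, hby, huni⟩ := hS.pair_of_B b ((hB b).2 (.inl rfl))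
  obtain ⟨x', y', hxy', hx', hy', hbx', hby', huni'⟩ := hS.pair_of_B b' ((hB b').2 (.inr rfl))
  have hcross : ∀ z, S z = A → G.Adj b z → ¬ G.Adj b' z := by
    intro z hz h1 h2
    obtain ⟨c, -, -, huc⟩ := hS.unique_of_A z hz
    exact hbb ((huc b h1.symm ((hB b).2 (.inl rfl))).trans
      (huc b' h2.symm ((hB b').2 (.inr rfl))).symm)
  have hA : ∀ z, S z = A → z = x ∨ z = y ∨ z = x' ∨ z = y' := by
    intro z hz
    obtain ⟨c, hcB, hzc, -⟩ := hS.unique_of_A z hz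
    rcases (hB c).1 hcB with rfl | rfl
    · have := huni z hzc.symm hz
      tauto
    · have := huni' z hzc.symm hz
      tauto
  have hAB : ∀ z w, S z = A → S w = B → w ≠ z := by
    rintro z w hz hw rfl
    rw [hz] at hw
    cases hw
  have hbB := (hB b).2 (.inl rfl)
  have hbB' := (hB b').2 (.inr rfl)
  have hxx' : x ≠ x' := fun h => hcross x hx hbx (h ▸ hbx')
  have hxy'' : x ≠ y' := fun h => hcross x hx hbx (h ▸ hby')
  have hyx' : y ≠ x' := fun h => hcross y hy hby (h ▸ hbx')
  have hyy' : y ≠ y' := fun h => hcross y hy hby (h ▸ hby')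
  have hl : [b, b', x, y, x', y'].Nodup := by
    simp [hbb, hxy, hxy', hxx', hxy'', hyx', hyy', hAB x b hx hbB, hAB y b hy hbB,
      hAB x' b hx' hbB, hAB y' b hy' hbB, hAB x b' hx hbB', hAB y b' hy hbB',
      hAB x' b' hx' hbB', hAB y' b' hy' hbB']
  have hrest : #(univ \ [b, b', x, y, x', y'].toFinset) = 2 := by
    rw [card_sdiff_of_subset (subset_univ _), card_univ, hcard, List.toFinset_card_of_nodup hl]
    rfl
  obtain ⟨c, c', hcc, heq⟩ := card_eq_two.1 hrest
  have hcmem : ∀ z, z = c ∨ z = c' → z ∉ [b, b', x, y, x', y'] ∧ G.Adj b z ∧ G.Adj b' z := by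
    intro z hz
    have h1 : z ∈ univ \ [b, b', x, y, x', y'].toFinset := by rw [heq]; simpa using hz
    rw [mem_sdiff, List.mem_toFinset] at h1
    refine ⟨h1.2, ?_⟩
    have h2 := h1.2
    simp only [List.mem_cons, List.not_mem_nil, or_false, not_or] at h2
    rcases hSz : S z with _ | _ | _
    · have := hA z hSz
      tauto
    · have := (hB z).1 hSz
      tauto
    · obtain ⟨p, q, hpq, hp, hq, hzp, hzq⟩ := hS.pair_of_C z hSz
      rcases (hB p).1 hp with rfl | rfl <;> rcases (hB q).1 hq with rfl | rfl
      · exact absurd rfl hpq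
      · exact ⟨hzp.symm, hzq.symm⟩
      · exact ⟨hzq.symm, hzp.symm⟩
      · exact absurd rfl hpq
  obtain ⟨hc1, hbc, hbc'⟩ := hcmem c (.inl rfl)
  obtain ⟨hc2, hbd, hbd'⟩ := hcmem c' (.inr rfl)
  have hl8 : [b, c, b', c', x, y, x', y'].Nodup := by
    have hperm : [b, c, b', c', x, y, x', y'].Perm (c :: c' :: [b, b', x, y, x', y']) := by
      refine (List.Perm.swap c b _).trans (.cons c ?_)
      exact ((List.Perm.swap c' b' _).cons b).trans (List.Perm.swap c' b _)
    rw [hperm.nodup_iff, List.nodup_cons, List.nodup_cons]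
    exact ⟨fun h => (List.mem_cons.1 h).elim hcc hc1, hc2, hl⟩
  refine ⟨⟨fun i => [b, c, b', c', x, y, x', y'].get i, ?_⟩, List.nodup_iff_injective_get.1 hl8⟩
  intro i j hij
  rw [unicyclic8, SimpleGraph.fromEdgeSet_adj] at hij
  simp only [Set.mem_insert_iff, Set.mem_singleton_iff, Sym2.eq_iff] at hij
  rcases hij.1 with h | h | h | h | h | h | h | h <;> rcases h with ⟨rfl, rfl⟩ | ⟨rfl, rfl⟩
  exacts [hbc, hbc.symm, hbc'.symm, hbc', hbd', hbd'.symm, hbd.symm, hbd, hbx, hbx.symm,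
    hby, hby.symm, hbx', hbx'.symm, hby', hby'.symm]

theorem InRUVR.nonempty_iso_unicyclic8 (hG : InRUVR G) (hc : G.Connected)
    (hcard : Fintype.card V = 8) (hsize : G.edgeSet.ncard ≤ 8) :
    Nonempty (G ≃g unicyclic8) := by
  obtain ⟨B', hrdf, hnum, h3⟩ := hG.exists_twice
  have hB := three_mul_card_le h3
  rw [hcard] at hB
  obtain hB0 | hB1 | hB2 : #B' = 0 ∨ #B' = 1 ∨ #B' = 2 := by omega
  · rw [card_eq_zero] at hB0
    obtain ⟨v⟩ := hc.nonempty
    obtain ⟨w, -, hw⟩ := hrdf v (by simp [twice_eq_zero, hB0])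
    simp [twice_eq_two, hB0] at hw
  · -- two universal vertices give thirteen edges
    obtain ⟨v, rfl⟩ := card_eq_one.1 hB1
    obtain ⟨u, huv, hu, hv⟩ := hG.exists_universal (by omega) hrdf (by simpa using hnum)
    obtain ⟨f, hf⟩ := exists_join_hom (m := 6) hcard huv hu hv
    have h1 := ncard_edgeSet_le_of_injective f hf
    have h2 : (join (⊤ : SimpleGraph (Fin 2)) (⊤ : SimpleGraph (Fin 6))ᶜ).edgeSet.ncard = 13 := by
      rw [Set.ncard_eq_toFinset_card']
      decide
    omega
  · obtain ⟨b, b', hbb, rfl⟩ := card_eq_two.1 hB2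
    have hdom : ∀ v, v ≠ b → v ≠ b' → G.Adj v b ∨ G.Adj v b' := by
      intro v h1 h2
      obtain ⟨w, hw, hw2⟩ := hrdf v (by simp [twice_eq_zero, h1, h2])
      simp only [twice_eq_two, mem_insert, mem_singleton] at hw2
      rcases hw2 with rfl | rfl
      · exact .inl hw
      · exact .inr hw
    have hlt : ∀ x ∈ ({b, b'} : Finset V), #((privateNbrs G {b, b'} x).erase x) < 3 := by
      intro x hx
      obtain ⟨g, hg, hw⟩ := hG.exists_isRDFOff x
      rw [hnum, hB2] at hw
      rcases mem_insert.1 hx with rfl | hx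
      · refine card_private_lt_three hc hcard hsize hbb hdom (fun v => ?_) hg hw
        rw [mem_erase, mem_privateNbrs]
        simp only [mem_insert, mem_singleton, forall_eq_or_imp, forall_eq]
        have : G.Adj v x → v ≠ x := fun h => h.ne
        have := hbb.symm
        tauto
      · rw [mem_singleton] at hx
        subst hx
        refine card_private_lt_three hc hcard hsize hbb.symm
          (fun v h1 h2 => (hdom v h2 h1).symm) (fun v => ?_) hg hw
        rw [mem_erase, mem_privateNbrs]
        simp only [mem_insert, mem_singleton, forall_eq_or_imp, forall_eq]
        have : G.Adj v x → v ≠ x := fun h => h.ne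
        tauto
    obtain ⟨S, hS, hSB⟩ := RomanUVR.exists_isStatusLabeling hrdf h3 hlt
    obtain ⟨f, hf⟩ := exists_unicyclic8_hom hcard hS hbb fun v => by rw [← hSB]; simp
    refine nonempty_iso_of_injective f hf ?_ (by rwa [ncard_edgeSet_unicyclic8])
    rw [Nat.card_eq_fintype_card, Nat.card_eq_fintype_card, hcard, Fintype.card_fin]

end Eight

end RomanUVR

theorem theorem4p4 {V : Type*} [Fintype V] [DecidableEq V] (n : ℕ) (hn : Fintype.card V = n) :
    -- (i)
    ((IsLeast (RomanUVR.connectedSizes V) (n - 1) ↔ n = 3 ∨ n = 6 ∨ n = 7 ∨ 9 ≤ n) ∧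
      ∀ G : SimpleGraph V, RomanUVR.IsMinimumSize G →
        (G.edgeSet.ncard = n - 1 ↔
          (n = 3 ∨ n = 6 ∨ n = 7 ∨ 9 ≤ n) ∧ RomanUVR.InFamilyT G)) ∧
    -- (ii)
    (n = 4 ∨ n = 5 →
      IsLeast (RomanUVR.connectedSizes V) (2 * n - 3) ∧
      ∀ G : SimpleGraph V, RomanUVR.IsMinimumSize G ↔
        Nonempty (G ≃g RomanUVR.join (⊤ : SimpleGraph (Fin 2)) (⊤ : SimpleGraph (Fin (n - 2)))ᶜ)) ∧
    -- (iii)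
    (n = 8 →
      IsLeast (RomanUVR.connectedSizes V) 8 ∧
      ∀ G : SimpleGraph V, RomanUVR.IsMinimumSize G ↔
        Nonempty (G ≃g RomanUVR.unicyclic8)) := by
  subst hn
  refine ⟨⟨⟨?_, fun h => ?_⟩, fun G hG => ?_⟩, fun h => RomanUVR.isLeast_join h rfl, fun h => ?_⟩
  · rintro ⟨⟨G, hc, hR, hsize⟩, -⟩
    have hle := RomanUVR.card_le_ncard_add_one hc
    have hpos := Fintype.card_pos_iff.2 hc.nonempty
    exact (RomanUVR.inFamilyT_iff.2 ⟨RomanUVR.isTree_iff_ncard.2 ⟨hc, by omega⟩, hR⟩).card_mem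
  · obtain ⟨a, b, hab⟩ := RomanUVR.exists_eq_add_of_mem h
    obtain ⟨G, hG⟩ := RomanUVR.exists_inFamilyT hab
    obtain ⟨hT, hR⟩ := RomanUVR.inFamilyT_iff.1 hG
    have hsize := (RomanUVR.isTree_iff_ncard.1 hT).2
    refine ⟨⟨G, hT.connected, hR, by omega⟩, ?_⟩
    rintro _ ⟨H, hc, -, rfl⟩
    have := RomanUVR.card_le_ncard_add_one hc
    omega
  · obtain ⟨hc, hR, -⟩ := hG
    have hpos := Fintype.card_pos_iff.2 hc.nonempty
    refine ⟨fun hsize => ?_, fun ⟨_, hT⟩ => ?_⟩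
    · have hT := RomanUVR.inFamilyT_iff.2 ⟨RomanUVR.isTree_iff_ncard.2 ⟨hc, by omega⟩, hR⟩
      exact ⟨hT.card_mem, hT⟩
    · have := (RomanUVR.isTree_iff_ncard.1 (RomanUVR.inFamilyT_iff.1 hT).1).2
      omega
  · have key := RomanUVR.isLeast_and_isMinimumSize_iff (V := V) (H := RomanUVR.unicyclic8)
      (by rw [h, Fintype.card_fin]) RomanUVR.connected_unicyclic8 RomanUVR.inRUVR_unicyclic8
    rw [RomanUVR.ncard_edgeSet_unicyclic8] at key
    refine key fun G hc hR => ⟨?_, hR.nonempty_iso_unicyclic8 hc h⟩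
    by_contra! hlt
    have hle := RomanUVR.card_le_ncard_add_one hc
    have hT := RomanUVR.inFamilyT_iff.2 ⟨RomanUVR.isTree_iff_ncard.2 ⟨hc, by omega⟩, hR⟩
    have := hT.card_mem
    omega
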